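/- **Conventions.** Let $C_4=\mathbb Z/4$. A *colour* $c$ consists of nodes $u_c:0\to1$ (unit), $e_c:1\to0$ (counit), $m_c:2\to1$ (multiplication), $d_c:1\to2$ (comultiplication) and $c_\theta:1\to1$ for $\theta\in C_4$ (phase gates). Write $f;g$ for "first $f$, then $g$", $\otimes$ for juxtaposition, $\sigma$ for the crossing of two wires, $1$ for the wire. The spider $c^{m,n}$ is the $m$-fold multiplication followed by the $n$-fold comultiplication (the $0$-fold ones being $u_c$, $e_c$, the $1$-fold ones the wire), and $c^{m,n}_\theta$ is the same with $c_\theta$ in between. Put $\mathrm{cup}_c=u_c;d_c$ and $\mathrm{cap}_c=m_c;e_c$. Given generators and rules, the presented category is the strict symmetric monoidal category with objects $*^n$ $(n\ge0)$ whose morphisms $*^m\to *^n$ are the diagrams with $m$ inputs and $n$ outputs built from the generators and symmetries by composition and juxtaposition, modulo the least congruence (for both operations) that contains the symmetric monoidal axioms and the rules, where moreover connected components attached to no input and no output are ignored (every diagram $0\to0$ equals the empty one). In all cases the legs of nodes are unordered ($\sigma;m_c=m_c$ for every colour), and the rules are closed under the flip $\dagger$: reverse composition, exchange $u_c\leftrightarrow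 e_c$, $m_c\leftrightarrow d_c$, $c_\theta\mapsto c_{-\theta}$ and keep $H$. **$\mathbf{RG}$** has colours $g$ (green), $r$ (red), a generator $H:1\to1$, and the rules - $g^{m,n}_0=g^{m,n}$; $\;g^{1,1}=1$; two green spiders labelled $\alpha,\beta$ joined by $k\ge1$ wires equal one green spider labelled $\alpha+\beta$ with the remaining legs; - $(d_g\otimes d_g);(1\otimes\sigma\otimes1);(m_r\otimes m_r)=m_r;d_g$; $\;u_r;d_g=u_r\otimes u_r$; $\;\mathrm{cup}_g=\mathrm{cup}_r$; - $r_2;d_g=d_g;(r_2\otimes r_2)$; $\;g_2;r_\theta=r_{-\theta};g_2$; - $H;H=1$; $\;g^{m,n}_\theta=H^{\otimes m};r^{m,n}_\theta;H^{\otimes n}$. **$\mathbf{RG}^+$** is the quotient of $\mathbf{RG}$ by the Euler decomposition $H=g_1;r_1;g_1$ (imposed inside arbitrary diagrams), with quotient functor $Q:\mathbf{RG}\to\mathbf{RG}^+$. **$\mathbf{RGB}$** has colours $r,g,b$ (red, green, blue) and the rules - the same spider rules for $g$; - $u_b;d_g=u_b\otimes u_b$; $\;m_r;r_3;e_g=e_g\otimes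 e_g$; $\;(d_g\otimes d_g);(1\otimes\sigma\otimes1);((m_r;r_3)\otimes(m_r;r_3))=m_r;r_3;d_g$; - $(1\otimes u_r);m_g=g_1$; - with $R:=g_1;b_1$ and $L:=R;R$: $\;R=r_1;g_1=b_1;r_1$ and $L^{\otimes m};b^{m,n}_\theta;R^{\otimes n}=g^{m,n}_\theta=R^{\otimes m};r^{m,n}_\theta;L^{\otimes n}$; - with $D_{c,c'}:=(1\otimes\mathrm{cup}_c);(\mathrm{cap}_{c'}\otimes1)$: $\;D_{g,r}=D_{r,g}=r_2$, $\;D_{b,g}=D_{g,b}=g_2$, $\;D_{r,b}=D_{b,r}=b_2$. **Translations.** On generators, $T$ sends every green node to the same green node, and $e_r\mapsto r_3;e_r$, $r_\theta\mapsto r_\theta$, $u_r\mapsto u_r;r_1$, $d_r\mapsto r_1;d_r$, $m_r\mapsto m_r;r_3$, $H\mapsto g_1;r_1;g_1$. On generators, $S$ sends every green node to the same green node, and $e_r\mapsto r_1;e_r$, $r_\theta\mapsto r_\theta$, $u_r\mapsto u_r;r_3$, $d_r\mapsto r_3;d_r$, $m_r\mapsto m_r;r_1$, and $e_b\mapsto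 e_r$, $b_\theta\mapsto g_3;r_\theta;g_1$, $u_b\mapsto u_r$, $d_b\mapsto g_3;d_r;(g_1\otimes g_1)$, $m_b\mapsto(g_3\otimes g_3);m_r;g_1$. **Theorem.** $T$ extends to a unique strict symmetric monoidal functor $T:\mathbf{RG}\to\mathbf{RGB}$ (the identity on objects); there is a unique functor $\hat T:\mathbf{RG}^+\to\mathbf{RGB}$ with $\hat T\circ Q=T$, and it is strict symmetric monoidal; $S$ extends to a unique strict symmetric monoidal functor $S:\mathbf{RGB}\to\mathbf{RG}^+$ (the identity on objects); and $S$ is the inverse functor of $\hat T$, i.e. $\hat T\circ S=\mathrm{id}_{\mathbf{RGB}}$ and $S\circ\hat T=\mathrm{id}_{\mathbf{RG}^+}$. In particular $\mathbf{RGB}$ and $\mathbf{RG}^+$ are isomorphic categories. -/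

import Mathlib

open CategoryTheory

namespace Chromatic

/-! ## Diagrams built from generators -/

/-- Terms for the string diagrams from `m` input wires to `n` output wires that are built from
the generators `G` and the symmetries by composition and disjoint union. -/
inductive Diagram (G : ℕ → ℕ → Type) : ℕ → ℕ → Type
  | gen {m n : ℕ} (g : G m n) : Diagram G m n
  | id (n : ℕ) : Diagram G n n
  | swap (m n : ℕ) : Diagram G (m + n) (n + m)
  | comp {m n p : ℕ} (f : Diagram G m n) (g : Diagram G n p) : Diagram G m p
  | tensor {m n p q : ℕ} (f : Diagram G m n) (g : Diagram G p q) : Diagram G (m + p) (n + q)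

/-- `f ⨟ g`: first `f` (drawn on top), then `g` (drawn below). -/
infixl:65 " ⨟ " => Diagram.comp

/-- `f ⊠ g`: `f` and `g` side by side. -/
infixl:70 " ⊠ " => Diagram.tensor

namespace Diagram

variable {G H : ℕ → ℕ → Type}

/-- The identity diagram between two equal numbers of wires. -/
def ofEq {m n : ℕ} (h : m = n) : Diagram G m n := h ▸ Diagram.id m

/-- `n` copies of a one-wire diagram side by side. -/
def power (f : Diagram G 1 1) : (n : ℕ) → Diagram G n n
  | 0 => Diagram.id 0
  | n + 1 => power f n ⊠ f

/-- Flip a diagram upside down, given the flip of every generator. -/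
def dagger (d : ∀ ⦃m n : ℕ⦄, G m n → G n m) : {m n : ℕ} → Diagram G m n → Diagram G n m
  | _, _, gen g => gen (d g)
  | _, _, id n => id n
  | _, _, swap m n => swap n m
  | _, _, comp f g => dagger d g ⨟ dagger d f
  | _, _, tensor f g => dagger d f ⊠ dagger d g

end Diagram

/-- A family of basic equations between parallel diagrams. -/
abbrev Rules (G : ℕ → ℕ → Type) : Type :=
  ∀ ⦃m n : ℕ⦄, Diagram G m n → Diagram G m n → Prop

/-- Equality of diagrams modulo the rules `R`: the least congruence (for composition and disjoint
union) that contains `R` and the axioms of a strict symmetric monoidal category, and for which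
closed diagrams (no inputs and no outputs) are ignored. -/
inductive DiagEq {G : ℕ → ℕ → Type} (R : Rules G) :
    ∀ {m n : ℕ}, Diagram G m n → Diagram G m n → Prop
  -- the rules
  | rule {m n : ℕ} {f g : Diagram G m n} : R f g → DiagEq R f g
  -- closed components are ignored
  | scalar (s : Diagram G 0 0) : DiagEq R s (Diagram.id 0)
  -- congruence
  | refl {m n : ℕ} (f : Diagram G m n) : DiagEq R f f
  | symm {m n : ℕ} {f g : Diagram G m n} : DiagEq R f g → DiagEq R g f
  | trans {m n : ℕ} {f g h : Diagram G m n} : DiagEq R f g → DiagEq R g h → DiagEq R f h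
  | comp {m n p : ℕ} {f f' : Diagram G m n} {g g' : Diagram G n p} :
      DiagEq R f f' → DiagEq R g g' → DiagEq R (f ⨟ g) (f' ⨟ g')
  | tensor {m n p q : ℕ} {f f' : Diagram G m n} {g g' : Diagram G p q} :
      DiagEq R f f' → DiagEq R g g' → DiagEq R (f ⊠ g) (f' ⊠ g')
  -- category axioms
  | id_comp {m n : ℕ} (f : Diagram G m n) : DiagEq R (Diagram.id m ⨟ f) f
  | comp_id {m n : ℕ} (f : Diagram G m n) : DiagEq R (f ⨟ Diagram.id n) f
  | assoc {m n p q : ℕ} (f : Diagram G m n) (g : Diagram G n p) (h : Diagram G p q) :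
      DiagEq R (f ⨟ g ⨟ h) (f ⨟ (g ⨟ h))
  -- strict monoidal axioms
  | tensor_id (m n : ℕ) :
      DiagEq R (Diagram.id m ⊠ Diagram.id n) (Diagram.id (m + n))
  | interchange {m n p m' n' p' : ℕ} (f : Diagram G m n) (g : Diagram G n p)
      (f' : Diagram G m' n') (g' : Diagram G n' p') :
      DiagEq R ((f ⨟ g) ⊠ (f' ⨟ g')) ((f ⊠ f') ⨟ (g ⊠ g'))
  | tensor_assoc {m n m' n' m'' n'' : ℕ} (f : Diagram G m n) (f' : Diagram G m' n')
      (f'' : Diagram G m'' n'') :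
      DiagEq R (f ⊠ f' ⊠ f'' ⨟ Diagram.ofEq (Nat.add_assoc n n' n''))
        (Diagram.ofEq (Nat.add_assoc m m' m'') ⨟ f ⊠ (f' ⊠ f''))
  | unit_tensor {m n : ℕ} (f : Diagram G m n) :
      DiagEq R (Diagram.id 0 ⊠ f ⨟ Diagram.ofEq (Nat.zero_add n))
        (Diagram.ofEq (Nat.zero_add m) ⨟ f)
  | tensor_unit {m n : ℕ} (f : Diagram G m n) : DiagEq R (f ⊠ Diagram.id 0) f
  -- symmetry axioms
  | swap_natural {m n p q : ℕ} (f : Diagram G m n) (g : Diagram G p q) :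
      DiagEq R (f ⊠ g ⨟ Diagram.swap n q) (Diagram.swap m p ⨟ g ⊠ f)
  | swap_swap (m n : ℕ) :
      DiagEq R (Diagram.swap m n ⨟ Diagram.swap n m) (Diagram.id (m + n))
  | hexagon (m n p : ℕ) :
      DiagEq R
        (Diagram.ofEq (Nat.add_assoc m n p) ⨟ Diagram.swap m (n + p)
          ⨟ Diagram.ofEq (Nat.add_assoc n p m))
        (Diagram.swap m n ⊠ Diagram.id p ⨟ Diagram.ofEq (Nat.add_assoc n m p)
          ⨟ Diagram.id n ⊠ Diagram.swap m p)

section Presented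

variable {G H : ℕ → ℕ → Type}

/-- Diagrams up to `DiagEq R`. -/
def diagSetoid (R : Rules G) (m n : ℕ) : Setoid (Diagram G m n) where
  r := DiagEq R
  iseqv := ⟨DiagEq.refl, DiagEq.symm, DiagEq.trans⟩

/-- Morphisms from `*^m` to `*^n` in the category presented by the generators `G` and rules `R`. -/
def Mor (R : Rules G) (m n : ℕ) : Type := Quotient (diagSetoid R m n)

namespace Mor

/-- The class of a diagram. -/
def mk (R : Rules G) {m n : ℕ} (f : Diagram G m n) : Mor R m n :=
  Quotient.mk (diagSetoid R m n) f

def comp {R : Rules G} {m n p : ℕ} (f : Mor R m n) (g : Mor R n p) : Mor R m p :=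
  Quotient.map₂ Diagram.comp (fun _ _ hf _ _ hg => DiagEq.comp hf hg) f g

def tensor {R : Rules G} {m n p q : ℕ} (f : Mor R m n) (g : Mor R p q) :
    Mor R (m + p) (n + q) :=
  Quotient.map₂ Diagram.tensor (fun _ _ hf _ _ hg => DiagEq.tensor hf hg) f g

end Mor

/-- The category presented by the generators `G` and the rules `R`.
Its objects are the tensor powers `*^n` of one object `*`. -/
structure DiagCat (R : Rules G) where
  arity : ℕ

instance (R : Rules G) : Category (DiagCat R) where
  Hom X Y := Mor R X.arity Y.arity
  id X := Mor.mk R (Diagram.id X.arity)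
  comp f g := Mor.comp f g
  id_comp f := Quotient.inductionOn f fun f => Quotient.sound (DiagEq.id_comp f)
  comp_id f := Quotient.inductionOn f fun f => Quotient.sound (DiagEq.comp_id f)
  assoc f g h := Quotient.inductionOn₃ f g h fun f g h => Quotient.sound (DiagEq.assoc f g h)

/-- Strict symmetric monoidal functors that send `*` to `*`. -/
@[ext]
structure StrictFunctor (R : Rules G) (R' : Rules H) where
  map : ∀ {m n : ℕ}, Mor R m n → Mor R' m n
  map_id : ∀ n : ℕ, map (Mor.mk R (Diagram.id n)) = Mor.mk R' (Diagram.id n)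
  map_comp : ∀ {m n p : ℕ} (f : Mor R m n) (g : Mor R n p),
    map (f.comp g) = (map f).comp (map g)
  map_tensor : ∀ {m n p q : ℕ} (f : Mor R m n) (g : Mor R p q),
    map (f.tensor g) = (map f).tensor (map g)
  map_swap : ∀ m n : ℕ, map (Mor.mk R (Diagram.swap m n)) = Mor.mk R' (Diagram.swap m n)

namespace StrictFunctor

variable {R : Rules G} {R' : Rules H}

/-- The underlying functor. -/
def toFunctor (F : StrictFunctor R R') : DiagCat R ⥤ DiagCat R' where
  obj X := ⟨X.arity⟩
  map f := F.map f
  map_id X := F.map_id X.arity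
  map_comp f g := F.map_comp f g

/-- `F` acts on the generators as prescribed by `φ`. -/
def ActsBy (F : StrictFunctor R R') (φ : ∀ ⦃m n : ℕ⦄, G m n → Diagram H m n) : Prop :=
  ∀ (m n : ℕ) (g : G m n), F.map (Mor.mk R (Diagram.gen g)) = Mor.mk R' (φ g)

end StrictFunctor

theorem DiagEq.mono {R R' : Rules G}
    (h : ∀ ⦃m n : ℕ⦄ (f g : Diagram G m n), R f g → R' f g) {m n : ℕ} {f g : Diagram G m n}
    (e : DiagEq R f g) : DiagEq R' f g := by
  induction e with
  | rule r => exact .rule (h _ _ r)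
  | scalar s => exact .scalar s
  | refl f => exact .refl f
  | symm _ ih => exact ih.symm
  | trans _ _ ih₁ ih₂ => exact ih₁.trans ih₂
  | comp _ _ ih₁ ih₂ => exact .comp ih₁ ih₂
  | tensor _ _ ih₁ ih₂ => exact .tensor ih₁ ih₂
  | id_comp f => exact .id_comp f
  | comp_id f => exact .comp_id f
  | assoc f g h => exact .assoc f g h
  | tensor_id m n => exact .tensor_id m n
  | interchange f g f' g' => exact .interchange f g f' g'
  | tensor_assoc f f' f'' => exact .tensor_assoc f f' f''
  | unit_tensor f => exact .unit_tensor f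
  | tensor_unit f => exact .tensor_unit f
  | swap_natural f g => exact .swap_natural f g
  | swap_swap m n => exact .swap_swap m n
  | hexagon m n p => exact .hexagon m n p

/-- The quotient functor obtained by adding rules. -/
def quotientFunctor (R R' : Rules G)
    (h : ∀ ⦃m n : ℕ⦄ (f g : Diagram G m n), R f g → R' f g) : StrictFunctor R R' where
  map := Quotient.map (fun f => f) fun _ _ e => DiagEq.mono h e
  map_id _ := rfl
  map_comp f g := Quotient.inductionOn₂ f g fun _ _ => rfl
  map_tensor f g := Quotient.inductionOn₂ f g fun _ _ => rfl
  map_swap _ _ := rfl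

end Presented

/-! ## Coloured nodes and spiders -/

/-- The five kinds of nodes of one colour. Phases are elements of the cyclic group `C₄`. -/
inductive Node : ℕ → ℕ → Type
  | unit : Node 0 1
  | counit : Node 1 0
  | mul : Node 2 1
  | comul : Node 1 2
  | phase (θ : ZMod 4) : Node 1 1

/-- Flip of a node: reverse the arrows and negate the angle. -/
def Node.dagger : {m n : ℕ} → Node m n → Node n m
  | _, _, .unit => .counit
  | _, _, .counit => .unit
  | _, _, .mul => .comul
  | _, _, .comul => .mul
  | _, _, .phase θ => .phase (-θ)

/-- A colour is a way to see nodes as generators. -/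
abbrev Colour (G : ℕ → ℕ → Type) : Type := ∀ ⦃m n : ℕ⦄, Node m n → G m n

namespace Colour

variable {G : ℕ → ℕ → Type}

def unit (c : Colour G) : Diagram G 0 1 := .gen (c .unit)
def counit (c : Colour G) : Diagram G 1 0 := .gen (c .counit)
def mul (c : Colour G) : Diagram G 2 1 := .gen (c .mul)
def comul (c : Colour G) : Diagram G 1 2 := .gen (c .comul)
def phase (c : Colour G) (θ : ZMod 4) : Diagram G 1 1 := .gen (c (.phase θ))

/-- The `m`-fold multiplication. -/
def muls (c : Colour G) : (m : ℕ) → Diagram G m 1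
  | 0 => c.unit
  | 1 => Diagram.id 1
  | m + 2 => (Colour.muls c (m + 1) ⊠ Diagram.id 1 : Diagram G (m + 2) 2) ⨟ c.mul

/-- The `n`-fold comultiplication. -/
def comuls (c : Colour G) : (n : ℕ) → Diagram G 1 n
  | 0 => c.counit
  | 1 => Diagram.id 1
  | n + 2 => c.comul ⨟ (Colour.comuls c (n + 1) ⊠ Diagram.id 1 : Diagram G 2 (n + 2))

/-- The node with `m` inputs, `n` outputs and no label. -/
def plainSpider (c : Colour G) (m n : ℕ) : Diagram G m n := c.muls m ⨟ c.comuls n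

/-- The node with `m` inputs, `n` outputs and label `θ`. -/
def spider (c : Colour G) (m n : ℕ) (θ : ZMod 4) : Diagram G m n := c.muls m ⨟ c.phase θ ⨟ c.comuls n

/-- The node with no inputs and two outputs. -/
def cup (c : Colour G) : Diagram G 0 2 := c.unit ⨟ c.comul

/-- The node with two inputs and no outputs. -/
def cap (c : Colour G) : Diagram G 2 0 := c.mul ⨟ c.counit

/-- Two spiders, with labels `α` and `β`, joined by `k` wires that run from the first to the
second. The first has `m` further inputs and `n` further outputs, the second `p` and `q`. -/
def joined (c : Colour G) (m n p q k : ℕ) (α β : ZMod 4) : Diagram G (m + p) (n + q) :=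
  c.spider m (n + k) α ⊠ Diagram.id p
    ⨟ Diagram.ofEq (Nat.add_assoc n k p)
    ⨟ Diagram.id n ⊠ c.spider (k + p) q β

/-- The two-wire diagram in which both inputs are split by the colour `c`, and one strand of each
is fed to each of two copies of `μ`. -/
def splitMerge (c : Colour G) (μ : Diagram G 2 1) : Diagram G 2 2 :=
  (c.comul ⊠ c.comul : Diagram G 2 4)
    ⨟ (Diagram.id 1 ⊠ Diagram.swap 1 1 ⊠ Diagram.id 1 : Diagram G 4 4)
    ⨟ (μ ⊠ μ : Diagram G 4 2)

/-- The wire bent by a cup of the colour `c` and a cap of the colour `d`. -/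
def dualizer (c d : Colour G) : Diagram G 1 1 :=
  (Diagram.id 1 ⊠ c.cup : Diagram G 1 3) ⨟ (d.cap ⊠ Diagram.id 1 : Diagram G 3 1)

end Colour

/-! ## The dichromatic calculus -/

/-- Generators of the dichromatic calculus: green and red nodes and the Hadamard gate. -/
inductive RGGen : ℕ → ℕ → Type
  | green {m n : ℕ} (k : Node m n) : RGGen m n
  | red {m n : ℕ} (k : Node m n) : RGGen m n
  | hadamard : RGGen 1 1

def RGGen.dagger : ⦃m n : ℕ⦄ → RGGen m n → RGGen n m
  | _, _, .green k => .green k.dagger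
  | _, _, .red k => .red k.dagger
  | _, _, .hadamard => .hadamard

namespace RG

def green : Colour RGGen := fun _ _ k => .green k
def red : Colour RGGen := fun _ _ k => .red k
def hadamard : Diagram RGGen 1 1 := .gen .hadamard

end RG

open RG in
/-- The rules of the dichromatic calculus. -/
inductive RGRule : ∀ ⦃m n : ℕ⦄, Diagram RGGen m n → Diagram RGGen m n → Prop
  -- the legs of a node are not ordered
  | green_comm : RGRule (Diagram.swap 1 1 ⨟ green.mul) green.mul
  | red_comm : RGRule (Diagram.swap 1 1 ⨟ red.mul) red.mul
  -- all equations hold under flip of arrows and negation of angles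
  | dagger {m n : ℕ} {f g : Diagram RGGen m n} :
      RGRule f g → RGRule (f.dagger RGGen.dagger) (g.dagger RGGen.dagger)
  -- spider rules
  | zero_label (m n : ℕ) : RGRule (green.spider m n 0) (green.plainSpider m n)
  | identity : RGRule (green.plainSpider 1 1) (Diagram.id 1)
  | fusion (m n p q k : ℕ) (hk : 1 ≤ k) (α β : ZMod 4) :
      RGRule (green.joined m n p q k α β) (green.spider (m + p) (n + q) (α + β))
  -- bialgebra rules
  | bialgebra : RGRule (green.splitMerge red.mul) (red.mul ⨟ green.comul)
  | copy : RGRule (red.unit ⨟ green.comul) (red.unit ⊠ red.unit)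
  | cups : RGRule green.cup red.cup
  -- rules for the phase `2`
  | pi_copy : RGRule (red.phase 2 ⨟ green.comul) (green.comul ⨟ red.phase 2 ⊠ red.phase 2)
  | pi_commute (θ : ZMod 4) :
      RGRule (green.phase 2 ⨟ red.phase θ) (red.phase (-θ) ⨟ green.phase 2)
  -- Hadamard rules
  | hadamard_sq : RGRule (hadamard ⨟ hadamard) (Diagram.id 1)
  | colour_change (m n : ℕ) (θ : ZMod 4) :
      RGRule (green.spider m n θ) (hadamard.power m ⨟ red.spider m n θ ⨟ hadamard.power n)

open RG in
/-- The rules of the dichromatic calculus together with the Euler decomposition of the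
Hadamard gate. -/
inductive RGPlusRule : ∀ ⦃m n : ℕ⦄, Diagram RGGen m n → Diagram RGGen m n → Prop
  | rg {m n : ℕ} {f g : Diagram RGGen m n} : RGRule f g → RGPlusRule f g
  | euler : RGPlusRule hadamard (green.phase 1 ⨟ red.phase 1 ⨟ green.phase 1)

/-! ## The trichromatic calculus -/

/-- Generators of the trichromatic calculus: red, green and blue nodes. -/
inductive RGBGen : ℕ → ℕ → Type
  | red {m n : ℕ} (k : Node m n) : RGBGen m n
  | green {m n : ℕ} (k : Node m n) : RGBGen m n
  | blue {m n : ℕ} (k : Node m n) : RGBGen m n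

def RGBGen.dagger : ⦃m n : ℕ⦄ → RGBGen m n → RGBGen n m
  | _, _, .red k => .red k.dagger
  | _, _, .green k => .green k.dagger
  | _, _, .blue k => .blue k.dagger

namespace RGB

def red : Colour RGBGen := fun _ _ k => .red k
def green : Colour RGBGen := fun _ _ k => .green k
def blue : Colour RGBGen := fun _ _ k => .blue k

/-- The colour changer in one direction. -/
def right : Diagram RGBGen 1 1 := green.phase 1 ⨟ blue.phase 1

/-- The colour changer in the other direction. -/
def left : Diagram RGBGen 1 1 := right ⨟ right

end RGB

open RGB in
/-- The rules of the trichromatic calculus. -/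
inductive RGBRule : ∀ ⦃m n : ℕ⦄, Diagram RGBGen m n → Diagram RGBGen m n → Prop
  -- the legs of a node are not ordered
  | red_comm : RGBRule (Diagram.swap 1 1 ⨟ red.mul) red.mul
  | green_comm : RGBRule (Diagram.swap 1 1 ⨟ green.mul) green.mul
  | blue_comm : RGBRule (Diagram.swap 1 1 ⨟ blue.mul) blue.mul
  -- all equations hold under flip of arrows and negation of angles
  | dagger {m n : ℕ} {f g : Diagram RGBGen m n} :
      RGBRule f g → RGBRule (f.dagger RGBGen.dagger) (g.dagger RGBGen.dagger)
  -- spider rules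
  | zero_label (m n : ℕ) : RGBRule (green.spider m n 0) (green.plainSpider m n)
  | identity : RGBRule (green.plainSpider 1 1) (Diagram.id 1)
  | fusion (m n p q k : ℕ) (hk : 1 ≤ k) (α β : ZMod 4) :
      RGBRule (green.joined m n p q k α β) (green.spider (m + p) (n + q) (α + β))
  -- bialgebra rules
  | copy : RGBRule (blue.unit ⨟ green.comul) (blue.unit ⊠ blue.unit)
  | cocopy : RGBRule (red.mul ⨟ red.phase 3 ⨟ green.counit) (green.counit ⊠ green.counit)
  | bialgebra :
      RGBRule (green.splitMerge (red.mul ⨟ red.phase 3)) (red.mul ⨟ red.phase 3 ⨟ green.comul)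
  -- a rotation as a multiplication
  | rotation : RGBRule ((Diagram.id 1 ⊠ red.unit : Diagram RGBGen 1 2) ⨟ green.mul) (green.phase 1)
  -- colour changers
  | right_red : RGBRule right (red.phase 1 ⨟ green.phase 1)
  | right_blue : RGBRule right (blue.phase 1 ⨟ red.phase 1)
  | colour_change_blue (m n : ℕ) (θ : ZMod 4) :
      RGBRule (left.power m ⨟ blue.spider m n θ ⨟ right.power n) (green.spider m n θ)
  | colour_change_red (m n : ℕ) (θ : ZMod 4) :
      RGBRule (green.spider m n θ) (right.power m ⨟ red.spider m n θ ⨟ left.power n)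
  -- dualizers
  | yellow : RGBRule (green.dualizer red) (red.dualizer green)
  | yellow_phase : RGBRule (red.dualizer green) (red.phase 2)
  | cyan : RGBRule (blue.dualizer green) (green.dualizer blue)
  | cyan_phase : RGBRule (green.dualizer blue) (green.phase 2)
  | magenta : RGBRule (red.dualizer blue) (blue.dualizer red)
  | magenta_phase : RGBRule (blue.dualizer red) (blue.phase 2)

/-! ## The three categories and the translations -/

/-- The category of the dichromatic calculus. -/
abbrev RGCat : Type := DiagCat RGRule

/-- The category of the dichromatic calculus modulo the Euler decomposition. -/
abbrev RGPlusCat : Type := DiagCat RGPlusRule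

/-- The category of the trichromatic calculus. -/
abbrev RGBCat : Type := DiagCat RGBRule

/-- The quotient functor from the dichromatic calculus to its quotient by the Euler
decomposition. -/
def eulerQuotient : StrictFunctor RGRule RGPlusRule :=
  quotientFunctor RGRule RGPlusRule fun _ _ _ _ h => .rg h

open RGB in
/-- Translation of dichromatic generators to trichromatic diagrams. -/
def translateT : ⦃m n : ℕ⦄ → RGGen m n → Diagram RGBGen m n
  | _, _, .green k => .gen (.green k)
  | _, _, .red .counit => red.phase 3 ⨟ red.counit
  | _, _, .red (.phase θ) => red.phase θ
  | _, _, .red .unit => red.unit ⨟ red.phase 1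
  | _, _, .red .comul => red.phase 1 ⨟ red.comul
  | _, _, .red .mul => red.mul ⨟ red.phase 3
  | _, _, .hadamard => green.phase 1 ⨟ red.phase 1 ⨟ green.phase 1

open RG in
/-- Translation of trichromatic generators to dichromatic diagrams. -/
def translateS : ⦃m n : ℕ⦄ → RGBGen m n → Diagram RGGen m n
  | _, _, .green k => .gen (.green k)
  | _, _, .red .counit => red.phase 1 ⨟ red.counit
  | _, _, .red (.phase θ) => red.phase θ
  | _, _, .red .unit => red.unit ⨟ red.phase 3
  | _, _, .red .comul => red.phase 3 ⨟ red.comul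
  | _, _, .red .mul => red.mul ⨟ red.phase 1
  | _, _, .blue .counit => red.counit
  | _, _, .blue (.phase θ) => green.phase 3 ⨟ red.phase θ ⨟ green.phase 1
  | _, _, .blue .unit => red.unit
  | _, _, .blue .comul => green.phase 3 ⨟ red.comul ⨟ green.phase 1 ⊠ green.phase 1
  | _, _, .blue .mul => green.phase 3 ⊠ green.phase 3 ⨟ red.mul ⨟ green.phase 1

end Chromatic

open Chromatic

/-! A strict functor out of a presented category amounts to images of the generators that respect
the rules (`StrictFunctor.lift`, `StrictFunctor.ext_gen`). The theorem therefore reduces to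
soundness of the two translations (`RGB.trans_sound_plus`, `RGPlus.trans_sound`) and to the two
composites fixing generators (`RGB.eval_translateS`, `RGPlus.eval_translateT`). Flips commute with
the translations, so each equation is checked in one orientation only.

On a single wire everything happens in a monoid. The Euler decomposition makes the green and red
phases a `Clifford` structure: also H = r₁g₁r₁, the rotation R = r₁g₁ has order three, and g₂
inverts red phases. Conversely, `Clifford.of_rotation` recovers R³ = 1 and the involution H = g₁r₁g₁
from the trichromatic colour changers. Conjugation by an invertible gate on all wires is a strict
functor, so colours conjugate to green inherit the spider rules. Since R = Hr₃ and R² = r₁H,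
conjugating red by a rotation differs from conjugating it by H only in red phases, and these are
what the factors r₁ and r₃ in the translations compensate.

For S, the translated red and blue cups are the green cup with r₂, respectively g₂, on one leg, so
each dualizer reduces by a snake equation to a product of phases. For T, equality of cups comes from
the dualizer of green and red, and the copy rule from the blue one, because the blue unit is the
translated red unit.

The hard rule for T is the copying of r₂ (`PhasedFrobenius.pi_copy`). The phase r₁ is red
multiplication by a green state; pushed through the green comultiplication by the bialgebra law, it
becomes a ladder with one rung. Two ladders fuse, and the Hopf law, itself a consequence of the
bialgebra law, cuts the fused rung. Ignoring closed diagrams is essential: it is why a copied state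
absorbs phases exactly (`PhasedFrobenius.state_phase`). -/

namespace Chromatic

open MonoidalCategory

/-! ### Presented categories as symmetric monoidal categories -/

section Monoidal

variable {G : ℕ → ℕ → Type} {R : Rules G}

namespace DiagCat

/-- The identity between two objects of equal arity. -/
def arityIso (R : Rules G) {m n : ℕ} (h : m = n) : (⟨m⟩ : DiagCat R) ≅ ⟨n⟩ where
  hom := Mor.mk R (Diagram.ofEq h)
  inv := Mor.mk R (Diagram.ofEq h.symm)
  hom_inv_id := by subst h; exact Quotient.sound (DiagEq.id_comp _)
  inv_hom_id := by subst h; exact Quotient.sound (DiagEq.id_comp _)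

instance : MonoidalCategoryStruct (DiagCat R) where
  tensorObj X Y := ⟨X.arity + Y.arity⟩
  tensorHom f g := Mor.tensor f g
  whiskerLeft X _ _ f := Mor.tensor (Mor.mk R (Diagram.id X.arity)) f
  whiskerRight f Y := Mor.tensor f (Mor.mk R (Diagram.id Y.arity))
  tensorUnit := ⟨0⟩
  associator X Y Z := arityIso R (Nat.add_assoc X.arity Y.arity Z.arity)
  leftUnitor X := arityIso R (Nat.zero_add X.arity)
  rightUnitor X := arityIso R (Nat.add_zero X.arity)

theorem ofEq_comp {m n p : ℕ} (h : m = n) (h' : n = p) :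
    (Mor.mk R (Diagram.ofEq h)).comp (Mor.mk R (Diagram.ofEq h'))
      = Mor.mk R (Diagram.ofEq (h.trans h')) := by
  subst h h'
  exact Quotient.sound (DiagEq.id_comp _)

theorem ofEq_tensor {m n p q : ℕ} (h : m = n) (h' : p = q) :
    (Mor.mk R (Diagram.ofEq h)).tensor (Mor.mk R (Diagram.ofEq h'))
      = Mor.mk R (Diagram.ofEq (congrArg₂ (· + ·) h h')) := by
  subst h h'
  exact Quotient.sound (DiagEq.tensor_id _ _)

/-- Every structural isomorphism is an `ofEq`, and these are closed under composition and tensor.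
Pentagon and triangle thus compare two `ofEq` morphisms between the same arities, which agree by
proof irrelevance. -/
instance : MonoidalCategory (DiagCat R) :=
  MonoidalCategory.ofTensorHom
    (id_tensorHom_id := fun X Y => Quotient.sound (DiagEq.tensor_id _ _))
    (id_tensorHom := fun _ _ _ _ => rfl)
    (tensorHom_id := fun _ _ => rfl)
    (tensorHom_comp_tensorHom := fun f₁ f₂ g₁ g₂ => by
      induction f₁ using Quotient.inductionOn
      induction f₂ using Quotient.inductionOn
      induction g₁ using Quotient.inductionOn
      induction g₂ using Quotient.inductionOn
      exact Quotient.sound (DiagEq.interchange _ _ _ _).symm)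
    (associator_naturality := fun f₁ f₂ f₃ => Quotient.inductionOn₃ f₁ f₂ f₃
      fun _ _ _ => Quotient.sound (DiagEq.tensor_assoc _ _ _))
    (leftUnitor_naturality := fun f => Quotient.inductionOn f
      fun _ => Quotient.sound (DiagEq.unit_tensor _))
    (rightUnitor_naturality := fun f => Quotient.inductionOn f
      fun f => Quotient.sound
        (((DiagEq.comp_id _).trans (DiagEq.tensor_unit f)).trans (DiagEq.id_comp _).symm))
    (pentagon := fun W X Y Z =>
      (congrArg₂ Mor.comp (ofEq_tensor _ rfl)
        ((congrArg₂ Mor.comp rfl (ofEq_tensor rfl _)).trans (ofEq_comp _ _))).trans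
        ((ofEq_comp _ _).trans (ofEq_comp _ _).symm))
    (triangle := fun X Y =>
      (congrArg₂ Mor.comp rfl (ofEq_tensor rfl _)).trans
        ((ofEq_comp _ _).trans (ofEq_tensor _ rfl).symm))

/-- The crossing of two bundles of wires. -/
def swapIso (X Y : DiagCat R) : X ⊗ Y ≅ Y ⊗ X where
  hom := Mor.mk R (Diagram.swap X.arity Y.arity)
  inv := Mor.mk R (Diagram.swap Y.arity X.arity)
  hom_inv_id := Quotient.sound (DiagEq.swap_swap _ _)
  inv_hom_id := Quotient.sound (DiagEq.swap_swap _ _)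

theorem swapIso_hexagon (X Y Z : DiagCat R) :
    (α_ X Y Z).hom ≫ (swapIso X (Y ⊗ Z)).hom ≫ (α_ Y Z X).hom =
      (swapIso X Y).hom ▷ Z ≫ (α_ Y X Z).hom ≫ Y ◁ (swapIso X Z).hom := by
  rw [← Category.assoc, ← Category.assoc]
  exact Quotient.sound (DiagEq.hexagon X.arity Y.arity Z.arity)

instance : SymmetricCategory (DiagCat R) where
  braiding := swapIso
  braiding_naturality_right X _ _ f := Quotient.inductionOn f
    fun _ => Quotient.sound (DiagEq.swap_natural _ _)
  braiding_naturality_left f Z := Quotient.inductionOn f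
    fun _ => Quotient.sound (DiagEq.swap_natural _ _)
  hexagon_forward := swapIso_hexagon
  hexagon_reverse X Y Z := by
    -- The braiding is its own inverse, so the reverse hexagon is the inverse of the forward one
    -- with the objects cyclically permuted.
    have h : α_ Z X Y ≪≫ swapIso Z (X ⊗ Y) ≪≫ α_ X Y Z =
        whiskerRightIso (swapIso Z X) Y ≪≫ α_ X Z Y ≪≫ whiskerLeftIso X (swapIso Z Y) :=
      Iso.ext (swapIso_hexagon Z X Y)
    have h' := congrArg Iso.inv h
    simp only [Iso.trans_inv, Category.assoc] at h'
    exact h'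
  symmetry X Y := (swapIso X Y).hom_inv_id

end DiagCat

/-! ## Interpretation of diagrams -/

variable {G' : ℕ → ℕ → Type} {R' : Rules G'}

/-- The interpretation of diagrams that sends every generator to a given morphism. -/
def Diagram.eval (φ : ∀ ⦃m n : ℕ⦄, G m n → Mor R' m n) :
    {m n : ℕ} → Diagram G m n → Mor R' m n
  | _, _, .gen g => φ g
  | _, _, .id n => Mor.mk R' (.id n)
  | _, _, .swap m n => Mor.mk R' (.swap m n)
  | _, _, .comp f g => (eval φ f).comp (eval φ g)
  | _, _, .tensor f g => (eval φ f).tensor (eval φ g)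

theorem Diagram.eval_ofEq (φ : ∀ ⦃m n : ℕ⦄, G m n → Mor R' m n) {m n : ℕ} (h : m = n) :
    (Diagram.ofEq h).eval φ = Mor.mk R' (Diagram.ofEq h) := by
  subst h; rfl

theorem Diagram.eval_gen (f : Diagram G m n) :
    f.eval (fun _ _ g => Mor.mk R (.gen g)) = Mor.mk R f := by
  induction f with
  | gen g => rfl
  | id n => rfl
  | swap m n => rfl
  | comp f g hf hg => exact congrArg₂ Mor.comp hf hg
  | tensor f g hf hg => exact congrArg₂ Mor.tensor hf hg

namespace Mor

theorem id_comp {m n : ℕ} (f : Mor R m n) : (Mor.mk R (.id m)).comp f = f :=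
  Quotient.inductionOn f fun f => Quotient.sound (DiagEq.id_comp f)

theorem comp_id {m n : ℕ} (f : Mor R m n) : f.comp (Mor.mk R (.id n)) = f :=
  Quotient.inductionOn f fun f => Quotient.sound (DiagEq.comp_id f)

theorem assoc {m n p q : ℕ} (f : Mor R m n) (g : Mor R n p) (h : Mor R p q) :
    (f.comp g).comp h = f.comp (g.comp h) :=
  Quotient.inductionOn₃ f g h fun f g h => Quotient.sound (DiagEq.assoc f g h)

theorem scalar_eq (s : Mor R 0 0) : s = Mor.mk R (.id 0) :=
  Quotient.inductionOn s fun s => Quotient.sound (DiagEq.scalar s)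

end Mor

/-- The target is again a symmetric monoidal category with trivial scalars, so all clauses of the
congruence except the rules hold there automatically. Only `h` has to be checked for a given
interpretation. -/
theorem DiagEq.eval_eq {φ : ∀ ⦃m n : ℕ⦄, G m n → Mor R' m n}
    (h : ∀ ⦃m n : ℕ⦄ (f g : Diagram G m n), R f g → f.eval φ = g.eval φ) {m n : ℕ}
    {f g : Diagram G m n} (e : DiagEq R f g) : f.eval φ = g.eval φ := by
  induction e with
  | rule r => exact h _ _ r
  | scalar s => exact Mor.scalar_eq _
  | refl f => rfl
  | symm _ ih => exact ih.symm
  | trans _ _ ih₁ ih₂ => exact ih₁.trans ih₂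
  | comp _ _ ih₁ ih₂ => exact congrArg₂ Mor.comp ih₁ ih₂
  | tensor _ _ ih₁ ih₂ => exact congrArg₂ Mor.tensor ih₁ ih₂
  | id_comp f => exact Mor.id_comp _
  | comp_id f => exact Mor.comp_id _
  | assoc f g h => exact Mor.assoc _ _ _
  | tensor_id m n => exact id_tensorHom_id (C := DiagCat R') ⟨m⟩ ⟨n⟩
  | interchange f g f' g' =>
    exact (tensorHom_comp_tensorHom (C := DiagCat R') (X₁ := ⟨_⟩) (Y₁ := ⟨_⟩) (Z₁ := ⟨_⟩)
      (X₂ := ⟨_⟩) (Y₂ := ⟨_⟩) (Z₂ := ⟨_⟩) (f.eval φ) (f'.eval φ) (g.eval φ) (g'.eval φ)).symm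
  | tensor_assoc f f' f'' =>
    refine (congrArg _ (Diagram.eval_ofEq φ _)).trans (.trans ?_
      (congrArg (fun z => Mor.comp z _) (Diagram.eval_ofEq φ _).symm))
    exact associator_naturality (C := DiagCat R') (X₁ := ⟨_⟩) (X₂ := ⟨_⟩) (X₃ := ⟨_⟩)
      (Y₁ := ⟨_⟩) (Y₂ := ⟨_⟩) (Y₃ := ⟨_⟩) (f.eval φ) (f'.eval φ) (f''.eval φ)
  | unit_tensor f =>
    refine (congrArg _ (Diagram.eval_ofEq φ _)).trans (.trans ?_
      (congrArg (fun z => Mor.comp z _) (Diagram.eval_ofEq φ _).symm))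
    exact leftUnitor_naturality (C := DiagCat R') (X := ⟨_⟩) (Y := ⟨_⟩) (f.eval φ)
  | tensor_unit f =>
    have := rightUnitor_naturality (C := DiagCat R') (X := ⟨_⟩) (Y := ⟨_⟩) (f.eval φ)
    exact ((Category.comp_id _).symm.trans this).trans (Category.id_comp _)
  | swap_natural f g =>
    exact BraidedCategory.braiding_naturality (C := DiagCat R') (X := ⟨_⟩) (X' := ⟨_⟩)
      (Y := ⟨_⟩) (Y' := ⟨_⟩) (f.eval φ) (g.eval φ)
  | swap_swap m n => exact SymmetricCategory.symmetry (C := DiagCat R') ⟨m⟩ ⟨n⟩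
  | hexagon m n p =>
    simp only [Diagram.eval, Diagram.eval_ofEq]
    exact Quotient.sound (DiagEq.hexagon m n p)

namespace StrictFunctor

/-- The strict symmetric monoidal functor given by images of the generators that satisfy the
rules. -/
def lift (φ : ∀ ⦃m n : ℕ⦄, G m n → Mor R' m n)
    (h : ∀ ⦃m n : ℕ⦄ (f g : Diagram G m n), R f g → f.eval φ = g.eval φ) :
    StrictFunctor R R' where
  map := Quotient.lift (fun f => f.eval φ) fun _ _ e => DiagEq.eval_eq h e
  map_id _ := rfl
  map_comp f g := Quotient.inductionOn₂ f g fun _ _ => rfl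
  map_tensor f g := Quotient.inductionOn₂ f g fun _ _ => rfl
  map_swap _ _ := rfl

theorem map_eval {K : ℕ → ℕ → Type} (F : StrictFunctor R R')
    (φ : ∀ ⦃m n : ℕ⦄, K m n → Mor R m n) {m n : ℕ} (f : Diagram K m n) :
    F.map (f.eval φ) = f.eval fun _ _ k => F.map (φ k) := by
  induction f with
  | gen g => rfl
  | id n => exact F.map_id n
  | swap m n => exact F.map_swap m n
  | comp f g hf hg => exact (F.map_comp _ _).trans (congrArg₂ Mor.comp hf hg)
  | tensor f g hf hg => exact (F.map_tensor _ _).trans (congrArg₂ Mor.tensor hf hg)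

/-- A diagram is its own interpretation in the presented category, so a strict functor is determined
by its values on generators. -/
theorem map_mk (F : StrictFunctor R R') {m n : ℕ} (f : Diagram G m n) :
    F.map (Mor.mk R f) = f.eval fun _ _ g => F.map (Mor.mk R (.gen g)) := by
  rw [← Diagram.eval_gen f, map_eval]

theorem ext_gen {F F' : StrictFunctor R R'}
    (h : ∀ (m n : ℕ) (g : G m n), F.map (Mor.mk R (.gen g)) = F'.map (Mor.mk R (.gen g))) :
    F = F' := by
  apply StrictFunctor.ext
  funext m n f
  induction f using Quotient.inductionOn with
  | h f =>
    have e : (fun m n (g : G m n) => F.map (Mor.mk R (.gen g)))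
      = fun m n (g : G m n) => F'.map (Mor.mk R (.gen g)) := by
      funext m n g; exact h m n g
    exact (F.map_mk f).trans ((congrArg (fun φ => f.eval φ) e).trans (F'.map_mk f).symm)

end StrictFunctor

/-! ## Conjugation -/

/-- `n` copies of an endomorphism of one wire side by side. -/
def Mor.power (f : Mor R 1 1) : (n : ℕ) → Mor R n n
  | 0 => Mor.mk R (.id 0)
  | n + 1 => (Mor.power f n).tensor f

theorem Diagram.eval_power (φ : ∀ ⦃m n : ℕ⦄, G m n → Mor R' m n) (f : Diagram G 1 1) (n : ℕ) :
    (f.power n).eval φ = (f.eval φ).power n := by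
  induction n with
  | zero => rfl
  | succ n ih => exact congrArg (fun z => Mor.tensor z _) ih

namespace Mor

theorem tensor_comp_tensor {m n p m' n' p' : ℕ} (f : Mor R m n) (g : Mor R n p)
    (f' : Mor R m' n') (g' : Mor R n' p') :
    (f.tensor f').comp (g.tensor g') = (f.comp g).tensor (f'.comp g') :=
  tensorHom_comp_tensorHom (C := DiagCat R) (X₁ := ⟨m⟩) (Y₁ := ⟨n⟩) (Z₁ := ⟨p⟩)
      (X₂ := ⟨m'⟩) (Y₂ := ⟨n'⟩) (Z₂ := ⟨p'⟩) f f' g g'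

theorem id_tensor_id (m n : ℕ) :
    (Mor.mk R (.id m)).tensor (Mor.mk R (.id n)) = Mor.mk R (.id (m + n)) :=
  Quotient.sound (DiagEq.tensor_id m n)

theorem tensor_unit {m n : ℕ} (f : Mor R m n) : f.tensor (Mor.mk R (.id 0)) = f :=
  Quotient.inductionOn f fun f => Quotient.sound (DiagEq.tensor_unit f)

theorem swap_natural {m n p q : ℕ} (f : Mor R m n) (g : Mor R p q) :
    (f.tensor g).comp (Mor.mk R (.swap n q)) = (Mor.mk R (.swap m p)).comp (g.tensor f) :=
  Quotient.inductionOn₂ f g fun f g => Quotient.sound (DiagEq.swap_natural f g)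

theorem power_one (f : Mor R 1 1) : f.power 1 = f := by
  have := leftUnitor_naturality (C := DiagCat R) (X := ⟨1⟩) (Y := ⟨1⟩) f
  exact (comp_id _).symm.trans (this.trans (id_comp _))

theorem power_two (f : Mor R 1 1) : f.power 2 = f.tensor f :=
  congrArg (fun z => Mor.tensor z f) (power_one f)

theorem power_add (f : Mor R 1 1) (m n : ℕ) :
    f.power (m + n) = (f.power m).tensor (f.power n) := by
  induction n with
  | zero => exact (tensor_unit _).symm
  | succ n ih =>
    refine (congrArg (fun z => Mor.tensor z f) ih).trans ?_
    have := associator_naturality (C := DiagCat R) (X₁ := ⟨m⟩) (X₂ := ⟨n⟩) (X₃ := ⟨1⟩)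
      (Y₁ := ⟨m⟩) (Y₂ := ⟨n⟩) (Y₃ := ⟨1⟩) (f.power m) (f.power n) f
    exact (comp_id _).symm.trans (this.trans (id_comp _))

theorem power_comp_power {f g : Mor R 1 1} (n : ℕ) :
    (f.power n).comp (g.power n) = (f.comp g).power n := by
  induction n with
  | zero => exact id_comp _
  | succ n ih =>
    exact (tensor_comp_tensor _ _ _ _).trans (congrArg (fun z => Mor.tensor z _) ih)

theorem id_power (n : ℕ) : (Mor.mk R (.id 1)).power n = Mor.mk R (.id n) := by
  induction n with
  | zero => rfl
  | succ n ih => exact (congrArg (fun z => Mor.tensor z _) ih).trans (id_tensor_id _ _)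

/-- Conjugation of a diagram by `h` on every wire. -/
def conj (h h' : Mor R 1 1) {m n : ℕ} (f : Mor R m n) : Mor R m n :=
  ((h'.power m).comp f).comp (h.power n)

end Mor

/-- Conjugation by an invertible `h` on every wire. -/
def StrictFunctor.conj (h h' : Mor R 1 1) (hh' : h.comp h' = Mor.mk R (.id 1))
    (h'h : h'.comp h = Mor.mk R (.id 1)) : StrictFunctor R R where
  map f := Mor.conj h h' f
  map_id n := by
    rw [Mor.conj, Mor.comp_id, Mor.power_comp_power, h'h, Mor.id_power]
  map_comp {m n p} f g := by
    have e : (h.power n).comp (h'.power n) = Mor.mk R (.id n) := by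
      rw [Mor.power_comp_power, hh', Mor.id_power]
    simp only [Mor.conj, Mor.assoc]
    rw [← Mor.assoc (h.power n), e, Mor.id_comp]
  map_tensor f g := by
    simp only [Mor.conj, Mor.power_add, Mor.tensor_comp_tensor]
  map_swap m n := by
    simp only [Mor.conj, Mor.power_add]
    rw [Mor.swap_natural, Mor.assoc, Mor.tensor_comp_tensor, Mor.power_comp_power,
      Mor.power_comp_power, h'h, Mor.id_power, Mor.id_power, Mor.id_tensor_id, Mor.comp_id]

end Monoidal


/-! ## Frobenius algebras with phases in a symmetric monoidal category -/

section Frobenius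

universe v₁ u₁

variable {C : Type u₁} [Category.{v₁} C] [MonoidalCategory C] [SymmetricCategory C]

/-- A commutative Frobenius algebra together with an action of `C₄` by phases. -/
structure PhasedFrobenius (X : C) where
  u : 𝟙_ C ⟶ X
  e : X ⟶ 𝟙_ C
  m : X ⊗ X ⟶ X
  d : X ⟶ X ⊗ X
  ph : ZMod 4 → (X ⟶ X)
  ph_zero : ph 0 = 𝟙 X
  ph_add (α β : ZMod 4) : ph α ≫ ph β = ph (α + β)
  unit_mul : X ◁ u ≫ m = (ρ_ X).hom
  mul_unit : u ▷ X ≫ m = (λ_ X).hom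
  comul_counit : d ≫ X ◁ e = (ρ_ X).inv
  counit_comul : d ≫ e ▷ X = (λ_ X).inv
  ph_mul_right (θ : ZMod 4) : X ◁ ph θ ≫ m = m ≫ ph θ
  ph_mul_left (θ : ZMod 4) : ph θ ▷ X ≫ m = m ≫ ph θ
  ph_comul_right (θ : ZMod 4) : d ≫ X ◁ ph θ = ph θ ≫ d
  ph_comul_left (θ : ZMod 4) : d ≫ ph θ ▷ X = ph θ ≫ d
  comm : (β_ X X).hom ≫ m = m
  mul_assoc : m ▷ X ≫ m = (α_ X X X).hom ≫ X ◁ m ≫ m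
  comul_assoc : d ≫ d ▷ X ≫ (α_ X X X).hom = d ≫ X ◁ d
  frobenius_left : d ▷ X ≫ (α_ X X X).hom ≫ X ◁ m = m ≫ d
  frobenius_right : X ◁ d ≫ (α_ X X X).inv ≫ m ▷ X = m ≫ d

namespace PhasedFrobenius

variable {X : C} (F : PhasedFrobenius X)

/-- The node with no inputs and two outputs. -/
def cup : 𝟙_ C ⟶ X ⊗ X := F.u ≫ F.d

/-- The node with two inputs and no outputs. -/
def cap : X ⊗ X ⟶ 𝟙_ C := F.m ≫ F.e

theorem cup_mul : X ◁ F.cup ≫ (α_ X X X).inv ≫ F.m ▷ X = (ρ_ X).hom ≫ F.d := by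
  rw [cup, whiskerLeft_comp, Category.assoc, F.frobenius_right, reassoc_of% F.unit_mul]

theorem cap_mul : X ◁ F.d ≫ (α_ X X X).inv ≫ F.cap ▷ X = F.m ≫ (λ_ X).inv := by
  rw [cap, comp_whiskerRight, reassoc_of% F.frobenius_right, F.counit_comul]

/-- Slide `f` and `g` along the bent wire to its two ends; what remains between them is the snake
equation of the Frobenius form. -/
theorem dualize (f g : X ⟶ X) :
    X ◁ (F.cup ≫ X ◁ g) ≫ (α_ X X X).inv ≫ (f ▷ X ≫ F.cap) ▷ X
      = (ρ_ X).hom ≫ f ≫ g ≫ (λ_ X).inv := by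
  have h : X ◁ F.cup ≫ (α_ X X X).inv ≫ F.cap ▷ X = (ρ_ X).hom ≫ (λ_ X).inv := by
    rw [cap, comp_whiskerRight, reassoc_of% F.cup_mul, F.counit_comul]
  calc _ = (ρ_ X).hom ≫ f ≫ (ρ_ X).inv ≫ (X ◁ F.cup ≫ (α_ X X X).inv ≫ F.cap ▷ X)
        ≫ 𝟙_ C ◁ g := by
        have e1 : X ◁ X ◁ g ≫ (α_ X X X).inv ≫ f ▷ X ▷ X ≫ F.cap ▷ X
          = f ▷ (X ⊗ X) ≫ (α_ X X X).inv ≫ F.cap ▷ X ≫ 𝟙_ C ◁ g := by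
          rw [← associator_inv_naturality_left_assoc, whisker_exchange_assoc]
          congr 1
          rw [← whisker_exchange]
          monoidal
        rw [whiskerLeft_comp, comp_whiskerRight, Category.assoc, e1, whisker_exchange_assoc]
        simp
    _ = _ := by
        rw [h]; simp

/-- The crossing of a wire with one leg of a bent wire can be pulled out. -/
theorem crossing (c : 𝟙_ C ⟶ X ⊗ X) :
    X ◁ c ≫ (α_ X X X).inv ≫ (β_ X X).hom ▷ X ≫ (α_ X X X).hom
      = (ρ_ X).hom ≫ (λ_ X).inv ≫ c ▷ X ≫ (α_ X X X).hom ≫ X ◁ (β_ X X).hom := by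
  -- Naturality moves the wire across both legs of `c`; undoing one of the two crossings gives the
  -- claim.
  have h := BraidedCategory.braiding_naturality_right X c
  rw [BraidedCategory.braiding_tensor_right_hom, braiding_tensorUnit_right] at h
  have h2 := congrArg (fun z => z ≫ (α_ X X X).hom ≫ X ◁ (β_ X X).hom) h
  simp only [Category.assoc, Iso.inv_hom_id_assoc, ← whiskerLeft_comp,
    SymmetricCategory.symmetry, whiskerLeft_id, Category.comp_id] at h2
  exact h2

theorem cup_mul' : F.cup ▷ X ≫ (α_ X X X).hom ≫ X ◁ F.m = (λ_ X).hom ≫ F.d := by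
  rw [cup, comp_whiskerRight, Category.assoc, F.frobenius_left, reassoc_of% F.mul_unit]

/-- By the snake equation, a state on two wires is recovered from the endomorphism obtained by
bending one of its legs with the cap. This turns information about a dualizer into an equation
between cups. -/
theorem cup_bend (c : 𝟙_ C ⟶ X ⊗ X) :
    F.cup ≫ X ◁ ((ρ_ X).inv ≫ X ◁ c ≫ (α_ X X X).inv ≫ F.cap ▷ X ≫ (λ_ X).hom) = c := by
  have h : F.cup ▷ X ≫ (α_ X X X).hom ≫ X ◁ F.cap = (λ_ X).hom ≫ (ρ_ X).inv := by
    rw [cap, whiskerLeft_comp, reassoc_of% F.cup_mul', F.comul_counit]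
  calc _ = (ρ_ _).inv ≫ (F.cup ▷ (𝟙_ C) ≫ (X ⊗ X) ◁ c) ≫ (α_ _ _ _).inv ≫
        ((α_ X X X).hom ≫ X ◁ F.cap) ▷ X ≫ (ρ_ X).hom ▷ X := by
        monoidal
    _ = c ≫ (λ_ _).inv ≫ (α_ _ _ _).inv ≫
        (F.cup ▷ X ≫ (α_ X X X).hom ≫ X ◁ F.cap) ▷ X ≫ (ρ_ X).hom ▷ X := by
        rw [← whisker_exchange]
        monoidal
    _ = c := by
        rw [h]; monoidal

/-- Putting a cup into the right half of a bialgebra-shaped diagram turns the left multiplication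
into a comultiplication, whose second leg carries `p` and runs into `k`. This evaluates the
bialgebra law on a bent wire. -/
theorem merge {Y : C} (p : X ⟶ X) (k : X ⊗ X ⟶ Y) :
    (X ⊗ X) ◁ (F.cup ≫ X ◁ p) ≫ tensorμ X X X X ≫ (F.m ⊗ₘ k)
      = (ρ_ (X ⊗ X)).hom ≫ F.d ▷ X ≫ (α_ X X X).hom ≫ X ◁ (p ▷ X ≫ (β_ X X).hom ≫ k) := by
  calc _ = (α_ _ _ _).hom ≫ X ◁ (X ◁ (F.cup ≫ X ◁ p) ≫ (α_ X X X).inv ≫ (β_ X X).hom ▷ X ≫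
          (α_ X X X).hom) ≫ (α_ _ _ _).inv ≫ (F.m ▷ (X ⊗ X) ≫ X ◁ k) := by
        rw [tensorμ, MonoidalCategory.tensorHom_def]
        monoidal
    _ = (α_ _ _ _).hom ≫ X ◁ ((ρ_ X).hom ≫ (λ_ X).inv ≫ (F.cup ≫ X ◁ p) ▷ X ≫ (α_ X X X).hom ≫
          X ◁ (β_ X X).hom) ≫ (α_ _ _ _).inv ≫ (F.m ▷ (X ⊗ X) ≫ X ◁ k) := by
        rw [crossing]
    _ = (ρ_ _).hom ≫ X ◁ (λ_ X).inv ≫ X ◁ (F.cup ▷ X) ≫ X ◁ (α_ X X X).hom ≫ (α_ _ _ _).inv ≫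
        ((X ⊗ X) ◁ (p ▷ X ≫ (β_ X X).hom) ≫ F.m ▷ (X ⊗ X)) ≫ X ◁ k := by
        monoidal
    _ = (ρ_ _).hom ≫ X ◁ (λ_ X).inv ≫ (α_ _ _ _).inv ≫
        (X ◁ F.cup ≫ (α_ X X X).inv ≫ F.m ▷ X) ▷ X ≫ (α_ X X X).hom ≫
        X ◁ (p ▷ X ≫ (β_ X X).hom ≫ k) := by
        rw [whisker_exchange]
        monoidal
    _ = _ := by
        rw [cup_mul]; monoidal

variable (K : PhasedFrobenius X)

/-- The bialgebra law between the comultiplication of `F` and the multiplication of `K`. -/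
def Bialgebra : Prop :=
  (F.d ⊗ₘ F.d) ≫ tensorμ X X X X ≫ (K.m ⊗ₘ K.m) = K.m ≫ F.d

variable {F K}

/-- A state copied by `K` absorbs the other argument of the multiplication. -/
theorem state_mul (hc : F.cap = K.cap) (hu : F.u ≫ K.d = (λ_ (𝟙_ C)).inv ≫ (F.u ⊗ₘ F.u)) :
    X ◁ F.u ≫ K.m = (ρ_ X).hom ≫ F.e ≫ F.u := by
  have h : X ◁ F.u ≫ K.cap = (ρ_ X).hom ≫ F.e := by
    rw [← hc, cap, reassoc_of% F.unit_mul]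
  calc _ = X ◁ F.u ≫ (K.m ≫ (λ_ X).inv) ≫ (λ_ X).hom := by simp
    -- By `cap_mul` the multiplication is a comultiplication of its right argument followed by a
    -- cap. The state is copied there, and the cap consumes one copy.
    _ = X ◁ (F.u ≫ K.d) ≫ (α_ X X X).inv ≫ K.cap ▷ X ≫ (λ_ X).hom := by
        rw [← K.cap_mul]; monoidal
    _ = (ρ_ X).hom ≫ (ρ_ X).inv ≫ (ρ_ _).inv ≫ (X ◁ F.u) ▷ (𝟙_ C) ≫ ((X ⊗ X) ◁ F.u ≫
          K.cap ▷ X) ≫ (λ_ X).hom := by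
        rw [hu, MonoidalCategory.tensorHom_def]; monoidal
    _ = (ρ_ X).hom ≫ (ρ_ X).inv ≫ (X ◁ F.u ≫ K.cap) ≫ F.u := by
        rw [whisker_exchange]; monoidal
    _ = _ := by rw [h]; simp

/-- Insert `F.u` as the second argument of the bialgebra law and close the second output with `K.e`.
On one side the unit becomes the common cup, and `merge` leaves `F.d ≫ K.m`; on the other,
`state_mul` disconnects the diagram. -/
theorem hopf (hb : Bialgebra F K) (hcup : F.cup = K.cup) (hcap : F.cap = K.cap)
    (hu : F.u ≫ K.d = (λ_ (𝟙_ C)).inv ≫ (F.u ⊗ₘ F.u)) :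
    F.d ≫ K.m = F.e ≫ K.u := by
  have hm := K.merge (𝟙 X) (K.m ≫ K.e)
  have h1 : (F.d ≫ (ρ_ (X ⊗ X)).inv ≫ (X ⊗ X) ◁ F.cup) ≫ tensorμ X X X X ≫
      (K.m ⊗ₘ (K.m ≫ K.e)) = (ρ_ X).inv ≫ X ◁ F.u ≫ K.m ≫ F.d ≫ X ◁ K.e := by
    have h2 : F.d ≫ (ρ_ (X ⊗ X)).inv ≫ (X ⊗ X) ◁ F.cup =
        (ρ_ X).inv ≫ X ◁ F.u ≫ (F.d ⊗ₘ F.d) := by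
      rw [cup, MonoidalCategory.tensorHom_def, whisker_exchange_assoc]; monoidal
    have h3 : (K.m ⊗ₘ (K.m ≫ K.e)) = (K.m ⊗ₘ K.m) ≫ X ◁ K.e := by
      rw [← id_tensorHom, tensorHom_comp_tensorHom, Category.comp_id]
    have hb' : (F.d ⊗ₘ F.d) ≫ tensorμ X X X X ≫ (K.m ⊗ₘ K.m) ≫ X ◁ K.e
        = K.m ≫ F.d ≫ X ◁ K.e := by
      have := congrArg (fun z => z ≫ X ◁ K.e) hb
      simpa using this
    rw [h2, h3]
    simp only [Category.assoc, hb']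
  have h4 : F.cup ≫ X ◁ K.e = K.u ≫ (ρ_ X).inv := by
    rw [hcup, cup, Category.assoc, K.comul_counit]
  rw [whiskerLeft_id, Category.comp_id] at hm
  have h5 : K.d ▷ X ≫ (α_ X X X).hom ≫ X ◁ (𝟙 X ▷ X ≫ (β_ X X).hom ≫ K.m ≫ K.e)
      = K.m ≫ (ρ_ X).inv := by
    rw [id_whiskerRight, Category.id_comp, reassoc_of% K.comm, whiskerLeft_comp, reassoc_of% K.frobenius_left,
      K.comul_counit]
  rw [h5] at hm
  rw [hcup, Category.assoc, Category.assoc, hm, reassoc_of% (state_mul hcap hu)] at h1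
  simp only [Iso.inv_hom_id_assoc] at h1
  rw [← Category.assoc F.u F.d, ← cup, h4] at h1
  simp only [← Category.assoc] at h1
  exact (cancel_mono _).1 h1

/-- Two wires joined by a rung `f`, twice in a row: coassociativity on the left wire and
associativity on the right one collect both rungs into a single one. -/
theorem ladder_comp_ladder (K : PhasedFrobenius X) (f : X ⟶ X) :
    (K.d ▷ X ≫ (α_ X X X).hom ≫ X ◁ (f ▷ X ≫ K.m)) ≫
      (K.d ▷ X ≫ (α_ X X X).hom ≫ X ◁ (f ▷ X ≫ K.m))
    = K.d ▷ X ≫ (α_ X X X).hom ≫ X ◁ ((K.d ≫ (f ⊗ₘ f) ≫ K.m) ▷ X ≫ K.m) := by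
  have h1 : X ◁ (f ▷ X ≫ K.m) ≫ f ▷ X ≫ K.m
      = (α_ X X X).inv ≫ (f ⊗ₘ f) ▷ X ≫ K.m ▷ X ≫ K.m := by
    rw [whiskerLeft_comp, Category.assoc, whisker_exchange_assoc, K.mul_assoc,
      MonoidalCategory.tensorHom_def']
    monoidal
  calc _ = K.d ▷ X ≫ (α_ X X X).hom ≫ (X ◁ (f ▷ X ≫ K.m) ≫ K.d ▷ X) ≫ (α_ X X X).hom ≫
          X ◁ (f ▷ X ≫ K.m) := by simp
    _ = (K.d ≫ K.d ▷ X ≫ (α_ X X X).hom) ▷ X ≫ (α_ _ _ _).hom ≫ X ◁ (α_ _ _ _).hom ≫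
          X ◁ (X ◁ (f ▷ X ≫ K.m) ≫ f ▷ X ≫ K.m) := by
        rw [whisker_exchange]; monoidal
    _ = _ := by
        rw [h1, K.comul_assoc]; monoidal

/-- By `hψ`, `K.ph 1` is multiplication by the state `F.u ≫ F.ph 3`, so the bialgebra law carries it
through `F.d` and leaves a ladder with rung `F.ph 3`. Doing this twice gives `K.ph 2`, and `hK` says
that the fused rung falls apart, leaving `K.ph 2` on each wire. -/
theorem pi_copy (hb : Bialgebra F K) (hcup : F.cup = K.cup)
    (hψ : K.u ≫ K.ph 1 = F.u ≫ F.ph 3)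
    (hK : K.d ≫ (F.ph 3 ⊗ₘ F.ph 3) ≫ K.m = K.ph 2 ≫ K.e ≫ K.u ≫ K.ph 2) :
    K.ph 2 ≫ F.d = F.d ≫ (K.ph 2 ⊗ₘ K.ph 2) := by
  have h1 : K.ph 1 = (ρ_ X).inv ≫ X ◁ (F.u ≫ F.ph 3) ≫ K.m := by
    rw [← hψ, whiskerLeft_comp, Category.assoc, K.ph_mul_right, reassoc_of% K.unit_mul,
      Iso.inv_hom_id_assoc]
  have h2 : (F.u ≫ F.ph 3) ≫ F.d = K.cup ≫ X ◁ F.ph 3 := by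
    rw [← hcup, cup, Category.assoc, Category.assoc, F.ph_comul_right]
  have h3 : K.ph 1 ≫ F.d = F.d ≫ K.d ▷ X ≫ (α_ X X X).hom ≫ X ◁ (F.ph 3 ▷ X ≫ K.m) := by
    have hm := K.merge (F.ph 3) K.m
    rw [K.comm] at hm
    calc _ = (ρ_ X).inv ≫ X ◁ (F.u ≫ F.ph 3) ≫ (F.d ⊗ₘ F.d) ≫ tensorμ X X X X ≫
            (K.m ⊗ₘ K.m) := by
          rw [h1, hb]; simp
      _ = (ρ_ X).inv ≫ F.d ▷ (𝟙_ C) ≫ ((X ⊗ X) ◁ (K.cup ≫ X ◁ F.ph 3) ≫ tensorμ X X X X ≫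
            (K.m ⊗ₘ K.m)) := by
          rw [MonoidalCategory.tensorHom_def, ← h2, Category.assoc (F.d ▷ X), whisker_exchange_assoc]
          simp
      _ = _ := by
          rw [hm]; simp
  have h4 : K.ph 2 = K.ph 1 ≫ K.ph 1 := (K.ph_add 1 1).symm
  rw [h4, Category.assoc, h3, ← Category.assoc, h3, Category.assoc, K.ladder_comp_ladder, hK, ← h4]
  congr 1
  have h5 : (K.u ≫ K.ph 2) ▷ X ≫ K.m = (λ_ X).hom ≫ K.ph 2 := by
    rw [comp_whiskerRight, Category.assoc, K.ph_mul_left, reassoc_of% K.mul_unit]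
  have h6 : K.d ≫ X ◁ (K.ph 2 ≫ K.e) = K.ph 2 ≫ (ρ_ X).inv := by
    rw [whiskerLeft_comp, reassoc_of% K.ph_comul_right, K.comul_counit]
  calc _ = (K.d ≫ X ◁ (K.ph 2 ≫ K.e)) ▷ X ≫ (α_ _ _ _).hom ≫
        X ◁ ((K.u ≫ K.ph 2) ▷ X ≫ K.m) := by monoidal
    _ = _ := by
        rw [h5, h6, MonoidalCategory.tensorHom_def]; monoidal

/-- A state copied by `K` is fixed by the phases of `K`, if closed diagrams are trivial. -/
theorem state_phase (hs : ∀ s : 𝟙_ C ⟶ 𝟙_ C, s = 𝟙 _) (K : PhasedFrobenius X) {v : 𝟙_ C ⟶ X}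
    (hv : v ≫ K.d = (λ_ (𝟙_ C)).inv ≫ (v ⊗ₘ v)) (θ : ZMod 4) : v ≫ K.ph θ = v := by
  -- Written with its phase on a closed-off leg, the gate acts on a copied state by a closed factor
  -- only, which `hs` removes.
  have h : K.ph θ = K.d ≫ X ◁ (K.ph θ ≫ K.e) ≫ (ρ_ X).hom := by
    rw [whiskerLeft_comp, Category.assoc, reassoc_of% K.ph_comul_right, reassoc_of% K.comul_counit]
    simp
  have hs' := hs (v ≫ K.ph θ ≫ K.e)
  calc _ = (λ_ (𝟙_ C)).inv ≫ (v ⊗ₘ (v ≫ K.ph θ ≫ K.e)) ≫ (ρ_ X).hom := by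
        rw [h, reassoc_of% hv, MonoidalCategory.tensorHom_def, MonoidalCategory.tensorHom_def]
        rw [← h]
        simp
    _ = v := by
        rw [hs', MonoidalCategory.tensorHom_def]; monoidal

end PhasedFrobenius
end Frobenius

/-! ## Flipping diagrams -/

section Dagger

variable {G G' : ℕ → ℕ → Type}

/-- Rules that are closed under a flip of the generators. -/
class FlipRules (R : Rules G) where
  flip : ∀ ⦃m n : ℕ⦄, G m n → G n m
  sound : ∀ ⦃m n : ℕ⦄ (f g : Diagram G m n), R f g →
    DiagEq R (f.dagger flip) (g.dagger flip)

variable {R : Rules G} {R' : Rules G'}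

/-- Flipping the associativity and unit axioms moves the coercions between arities to the other
sides; this moves them back. -/
theorem DiagEq.ofEq_flip {a b c d : ℕ} {h : a = b} {h' : c = d} {f : Diagram G a c}
    {g : Diagram G b d} (e : DiagEq R (f ⨟ Diagram.ofEq h') (Diagram.ofEq h ⨟ g)) :
    DiagEq R (Diagram.ofEq h.symm ⨟ f) (g ⨟ Diagram.ofEq h'.symm) := by
  subst h h'
  exact (DiagEq.id_comp f).trans ((DiagEq.comp_id f).symm.trans
    (e.trans ((DiagEq.id_comp g).trans (DiagEq.comp_id g).symm)))

variable [FlipRules R] [FlipRules R']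

theorem Diagram.dagger_ofEq (fl : ∀ ⦃m n : ℕ⦄, G m n → G n m) {m n : ℕ} (h : m = n) :
    (Diagram.ofEq h).dagger fl = Diagram.ofEq h.symm := by
  subst h; rfl

theorem DiagEq.mk_dagger {m n : ℕ} {f g : Diagram G m n} (e : DiagEq R f g) :
    Mor.mk R (f.dagger (FlipRules.flip R)) = Mor.mk R (g.dagger (FlipRules.flip R)) := by
  induction e with
  | rule r => exact Quotient.sound (FlipRules.sound _ _ r)
  | scalar s => exact Mor.scalar_eq _
  | refl f => rfl
  | symm _ ih => exact ih.symm
  | trans _ _ ih₁ ih₂ => exact ih₁.trans ih₂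
  | comp _ _ ih₁ ih₂ => exact congrArg₂ Mor.comp ih₂ ih₁
  | tensor _ _ ih₁ ih₂ => exact congrArg₂ Mor.tensor ih₁ ih₂
  | id_comp f => exact Quotient.sound (DiagEq.comp_id _)
  | comp_id f => exact Quotient.sound (DiagEq.id_comp _)
  | assoc f g h => exact Quotient.sound (DiagEq.assoc _ _ _).symm
  | tensor_id m n => exact Mor.id_tensor_id m n
  | interchange f g f' g' => exact Quotient.sound (DiagEq.interchange _ _ _ _)
  | tensor_assoc f f' f'' =>
    simp only [Diagram.dagger, Diagram.dagger_ofEq]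
    exact Quotient.sound (DiagEq.ofEq_flip (DiagEq.tensor_assoc _ _ _))
  | unit_tensor f =>
    simp only [Diagram.dagger, Diagram.dagger_ofEq]
    exact Quotient.sound (DiagEq.ofEq_flip (DiagEq.unit_tensor _))
  | tensor_unit f => exact Quotient.sound (DiagEq.tensor_unit _)
  | swap_natural f g => exact Quotient.sound (DiagEq.swap_natural _ _).symm
  | swap_swap m n => exact Quotient.sound (DiagEq.swap_swap m n)
  | hexagon m n p =>
    simp only [Diagram.dagger, Diagram.dagger_ofEq]
    let A : ℕ → DiagCat R := fun n => ⟨n⟩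
    -- Every factor of the hexagon is invertible and its flip is its inverse, so the flipped axiom
    -- is the inverse of the hexagon.
    have h : α_ (A m) (A n) (A p) ≪≫ DiagCat.swapIso (A m) (A n ⊗ A p) ≪≫ α_ (A n) (A p) (A m) =
        whiskerRightIso (DiagCat.swapIso (A m) (A n)) (A p) ≪≫ α_ (A n) (A m) (A p) ≪≫
          whiskerLeftIso (A n) (DiagCat.swapIso (A m) (A p)) :=
      Iso.ext (DiagCat.swapIso_hexagon _ _ _)
    have h' := congrArg Iso.inv h
    simp only [Iso.trans_inv, Category.assoc] at h'
    exact h'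

/-- Flip a morphism upside down. -/
def Mor.dagger {m n : ℕ} : Mor R m n → Mor R n m :=
  Quotient.lift (fun f => Mor.mk R (f.dagger (FlipRules.flip R))) fun _ _ e => DiagEq.mk_dagger e

theorem Mor.dagger_comp {m n p : ℕ} (f : Mor R m n) (g : Mor R n p) :
    (f.comp g).dagger = g.dagger.comp f.dagger :=
  Quotient.inductionOn₂ f g fun _ _ => rfl

theorem Mor.dagger_tensor {m n p q : ℕ} (f : Mor R m n) (g : Mor R p q) :
    (f.tensor g).dagger = f.dagger.tensor g.dagger :=
  Quotient.inductionOn₂ f g fun _ _ => rfl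

theorem Mor.dagger_power (f : Mor R 1 1) (n : ℕ) : (f.power n).dagger = f.dagger.power n := by
  induction n with
  | zero => rfl
  | succ n ih => exact (Mor.dagger_tensor _ _).trans (congrArg (fun z => Mor.tensor z _) ih)

theorem Mor.dagger_conj (h h' : Mor R 1 1) {m n : ℕ} (f : Mor R m n) :
    (Mor.conj h h' f).dagger = Mor.conj h'.dagger h.dagger f.dagger := by
  simp only [Mor.conj, Mor.dagger_comp, Mor.dagger_power, Mor.assoc]

theorem Diagram.eval_dagger {φ : ∀ ⦃m n : ℕ⦄, G m n → Mor R' m n}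
    {fl : ∀ ⦃m n : ℕ⦄, G m n → G n m} (h : ∀ ⦃m n : ℕ⦄ (g : G m n), φ (fl g) = (φ g).dagger)
    {m n : ℕ} (f : Diagram G m n) : (f.dagger fl).eval φ = (f.eval φ).dagger := by
  induction f with
  | gen g => exact h g
  | id n => rfl
  | swap m n => rfl
  | comp f g hf hg => exact (congrArg₂ Mor.comp hg hf).trans (Mor.dagger_comp _ _).symm
  | tensor f g hf hg => exact (congrArg₂ Mor.tensor hf hg).trans (Mor.dagger_tensor _ _).symm

end Dagger

/-! ## Colours in a presented category -/

/-- The nodes of one colour as generators on their own. -/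
def Colour.self : Colour Node := fun _ _ k => k

open Colour in
/-- The rules of the spiders of one colour. -/
inductive SpiderRule : ∀ ⦃m n : ℕ⦄, Diagram Node m n → Diagram Node m n → Prop
  | comm : SpiderRule (Diagram.swap 1 1 ⨟ self.mul) self.mul
  | dagger {m n : ℕ} {f g : Diagram Node m n} :
      SpiderRule f g → SpiderRule (f.dagger fun _ _ => Node.dagger) (g.dagger fun _ _ => Node.dagger)
  | zero_label (m n : ℕ) : SpiderRule (self.spider m n 0) (self.plainSpider m n)
  | identity : SpiderRule (self.plainSpider 1 1) (Diagram.id 1)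
  | fusion (m n p q k : ℕ) (hk : 1 ≤ k) (α β : ZMod 4) :
      SpiderRule (self.joined m n p q k α β) (self.spider (m + p) (n + q) (α + β))

/-- Morphisms that interpret the nodes of one colour. -/
abbrev MorColour {G : ℕ → ℕ → Type} (R : Rules G) : Type := ∀ ⦃m n : ℕ⦄, Node m n → Mor R m n

section Relabel

variable {G G' : ℕ → ℕ → Type} {R : Rules G} (φ : ∀ ⦃m n : ℕ⦄, G' m n → Mor R m n)
  (c : Colour G')

/-- The interpretation of a colour under an interpretation of the generators. -/
def Colour.under : MorColour R := fun _ _ k => φ (c k)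

/-- This and its companions reduce the spiders of any colour, under any interpretation, to those of
the free signature `Node`, so that spider rules need be treated only once. -/
theorem Colour.eval_muls (m : ℕ) : (c.muls m).eval φ = (Colour.self.muls m).eval (c.under φ) := by
  induction m using Nat.strong_induction_on with
  | _ m ih =>
    match m with
    | 0 => rfl
    | 1 => rfl
    | m + 2 => simp only [Colour.muls, Diagram.eval, ih (m + 1) (by omega)]; rfl

theorem Colour.eval_comuls (m : ℕ) :
    (c.comuls m).eval φ = (Colour.self.comuls m).eval (c.under φ) := by
  induction m using Nat.strong_induction_on with
  | _ m ih =>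
    match m with
    | 0 => rfl
    | 1 => rfl
    | m + 2 => simp only [Colour.comuls, Diagram.eval, ih (m + 1) (by omega)]; rfl

theorem Colour.eval_spider (m n : ℕ) (θ : ZMod 4) :
    (c.spider m n θ).eval φ = (Colour.self.spider m n θ).eval (c.under φ) := by
  simp only [Colour.spider, Diagram.eval, Colour.eval_muls φ c, Colour.eval_comuls φ c]; rfl

theorem Colour.eval_plainSpider (m n : ℕ) :
    (c.plainSpider m n).eval φ = (Colour.self.plainSpider m n).eval (c.under φ) := by
  simp only [Colour.plainSpider, Diagram.eval, Colour.eval_muls φ c, Colour.eval_comuls φ c]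

theorem Colour.eval_joined (m n p q k : ℕ) (α β : ZMod 4) :
    (c.joined m n p q k α β).eval φ = (Colour.self.joined m n p q k α β).eval (c.under φ) := by
  simp only [Colour.joined, Diagram.eval, Diagram.eval_ofEq, Colour.eval_spider φ c]

end Relabel

/-! ### Colours that satisfy the spider rules, and their conjugates -/

section SpiderColour

variable {G G' : ℕ → ℕ → Type} {R : Rules G} {R' : Rules G'}

namespace MorColour

/-- The spider rules hold for a colour. -/
def IsSpider (c : MorColour R) : Prop :=
  ∀ ⦃m n : ℕ⦄ (f g : Diagram Node m n), SpiderRule f g → f.eval c = g.eval c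

theorem IsSpider.map {c : MorColour R} (hc : c.IsSpider) (F : StrictFunctor R R') :
    IsSpider (R := R') fun _ _ k => F.map (c k) := fun _ _ f g h => by
  rw [← F.map_eval c f, ← F.map_eval c g, hc f g h]

/-- The conjugate of a colour. -/
def conj (c : MorColour R) (h h' : Mor R 1 1) : MorColour R := fun _ _ k => Mor.conj h h' (c k)

theorem IsSpider.conj {c : MorColour R} (hc : c.IsSpider) {h h' : Mor R 1 1}
    (hh' : h.comp h' = Mor.mk R (.id 1)) (h'h : h'.comp h = Mor.mk R (.id 1)) :
    (c.conj h h').IsSpider :=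
  hc.map (StrictFunctor.conj h h' hh' h'h)

theorem eval_conj (c : MorColour R) {h h' : Mor R 1 1}
    (hh' : h.comp h' = Mor.mk R (.id 1)) (h'h : h'.comp h = Mor.mk R (.id 1)) {m n : ℕ}
    (f : Diagram Node m n) : f.eval (c.conj h h') = Mor.conj h h' (f.eval c) :=
  ((StrictFunctor.conj h h' hh' h'h).map_eval c f).symm

/-- The node with `m` inputs, `n` outputs and label `θ`. -/
def spider (c : MorColour R) (m n : ℕ) (θ : ZMod 4) : Mor R m n := (Colour.self.spider m n θ).eval c

theorem spider_one_one (c : MorColour R) (θ : ZMod 4) : c.spider 1 1 θ = c (.phase θ) :=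
  (Mor.comp_id _).trans (Mor.id_comp _)

theorem spider_zero_one {c : MorColour R} (h : c (.phase 0) = Mor.mk R (.id 1)) :
    c.spider 0 1 0 = c .unit :=
  (Mor.comp_id _).trans ((congrArg _ h).trans (Mor.comp_id _))

theorem spider_one_zero {c : MorColour R} (h : c (.phase 0) = Mor.mk R (.id 1)) :
    c.spider 1 0 0 = c .counit :=
  (congrArg (fun z => Mor.comp (Mor.comp _ z) (c .counit)) h).trans
    ((congrArg (fun z => Mor.comp z _) (Mor.comp_id _)).trans (Mor.id_comp _))

theorem spider_two_one (c : MorColour R) (θ : ZMod 4) :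
    c.spider 2 1 θ = (c .mul).comp (c (.phase θ)) := by
  refine (Mor.comp_id _).trans (congrArg (fun z => Mor.comp z (c (.phase θ))) ?_)
  exact (congrArg (fun z => Mor.comp z (c .mul)) (Mor.id_tensor_id 1 1)).trans (Mor.id_comp _)

theorem spider_one_two (c : MorColour R) (θ : ZMod 4) :
    c.spider 1 2 θ = (c (.phase θ)).comp (c .comul) := by
  refine congrArg₂ Mor.comp (Mor.id_comp _) ?_
  exact (congrArg (fun z => Mor.comp (c .comul) z) (Mor.id_tensor_id 1 1)).trans (Mor.comp_id _)

theorem spider_two_two {c : MorColour R} (h : c (.phase 0) = Mor.mk R (.id 1)) :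
    c.spider 2 2 0 = (c .mul).comp (c .comul) := by
  have h1 : c.spider 2 2 0 = (c.spider 2 1 0).comp (c.spider 1 2 0) := by
    rw [spider_two_one, spider_one_two, h, Mor.comp_id, Mor.id_comp]
    refine congrArg₂ Mor.comp ?_ ?_
    · refine (congrArg (Mor.comp _) h).trans ((Mor.comp_id _).trans ?_)
      exact (congrArg (fun z => Mor.comp z (c .mul)) (Mor.id_tensor_id 1 1)).trans (Mor.id_comp _)
    · exact (congrArg (fun z => Mor.comp (c .comul) z) (Mor.id_tensor_id 1 1)).trans (Mor.comp_id _)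
  rw [h1, spider_two_one, spider_one_two, h, Mor.comp_id, Mor.id_comp]

theorem ext_node {c c' : MorColour R} (hu : c .unit = c' .unit) (he : c .counit = c' .counit)
    (hm : c .mul = c' .mul) (hd : c .comul = c' .comul) (hp : ∀ θ, c (.phase θ) = c' (.phase θ)) :
    c = c' := by
  funext m n k
  cases k
  exacts [hu, he, hm, hd, hp _]

/-- Colours with the same spiders are equal. -/
theorem ext_of_spider {c c' : MorColour R} (h : c (.phase 0) = Mor.mk R (.id 1))
    (hs : ∀ m n θ, c.spider m n θ = c'.spider m n θ) : c = c' := by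
  have hp : ∀ θ, c (.phase θ) = c' (.phase θ) := fun θ => by
    rw [← spider_one_one c, ← spider_one_one c', hs]
  -- Units, counits and binary nodes are spiders only once the label 0 is invisible; for `c'` this
  -- is inherited from `c` through the spiders with one input and one output.
  have h' : c' (.phase 0) = Mor.mk R (.id 1) := (hp 0).symm.trans h
  refine ext_node ?_ ?_ ?_ ?_ hp
  · rw [← spider_zero_one h, ← spider_zero_one h', hs]
  · rw [← spider_one_zero h, ← spider_one_zero h', hs]
  · rw [← Mor.comp_id (c .mul), ← h, ← spider_two_one, hs, spider_two_one, h', Mor.comp_id]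
  · rw [← Mor.id_comp (c .comul), ← h, ← spider_one_two, hs, spider_one_two, h', Mor.id_comp]

section

variable [FlipRules R]

/-- A colour is compatible with flips. -/
def Flips (c : MorColour R) : Prop := ∀ ⦃m n : ℕ⦄ (k : Node m n), c k.dagger = (c k).dagger

theorem Flips.conj {c : MorColour R} (hc : c.Flips) {h h' : Mor R 1 1} (hh : h.dagger = h')
    (hh' : h'.dagger = h) : (c.conj h h').Flips := fun _ _ k => by
  rw [MorColour.conj, MorColour.conj, Mor.dagger_conj, hc k, hh, hh']

/-- Counit and comultiplication are flips of unit and multiplication, so half of the nodes need no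
comparison. -/
theorem Flips.ext {c c' : MorColour R} (hc : c.Flips) (hc' : c'.Flips)
    (hu : c .unit = c' .unit) (hm : c .mul = c' .mul) (hp : ∀ θ, c (.phase θ) = c' (.phase θ)) :
    c = c' :=
  ext_node hu ((hc .unit).trans ((congrArg _ hu).trans (hc' .unit).symm)) hm
    ((hc .mul).trans ((congrArg _ hm).trans (hc' .mul).symm)) hp

end

theorem IsSpider.phase_zero {c : MorColour R} (hc : c.IsSpider) :
    c (.phase 0) = Mor.mk R (.id 1) :=
  (c.spider_one_one 0).symm.trans ((hc _ _ (.zero_label 1 1)).trans (hc _ _ .identity))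

end MorColour
end SpiderColour

/-! ### From spider rules to Frobenius algebras -/

section SpiderFrobenius

variable {G : ℕ → ℕ → Type} {R : Rules G}

theorem Colour.dagger_muls (m : ℕ) :
    (Colour.self.muls m).dagger (fun _ _ => Node.dagger) = Colour.self.comuls m := by
  induction m using Nat.strong_induction_on with
  | _ m ih =>
    match m with
    | 0 => rfl
    | 1 => rfl
    | m + 2 => simp only [Colour.muls, Diagram.dagger, ih (m + 1) (by omega)]; rfl

theorem Colour.dagger_comuls (m : ℕ) :
    (Colour.self.comuls m).dagger (fun _ _ => Node.dagger) = Colour.self.muls m := by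
  induction m using Nat.strong_induction_on with
  | _ m ih =>
    match m with
    | 0 => rfl
    | 1 => rfl
    | m + 2 => simp only [Colour.comuls, Diagram.dagger, ih (m + 1) (by omega)]; rfl

theorem Mor.id_zero_tensor {m n : ℕ} (f : Mor R m n) :
    ((Mor.mk R (.id 0)).tensor f).comp (Mor.mk R (Diagram.ofEq (Nat.zero_add n)))
      = (Mor.mk R (Diagram.ofEq (Nat.zero_add m))).comp f :=
  Quotient.inductionOn f fun f => Quotient.sound (DiagEq.unit_tensor f)

namespace MorColour

variable {c : MorColour R}

theorem eval_dagger_spider (m n : ℕ) (θ : ZMod 4) :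
    ((Colour.self.spider m n θ).dagger fun _ _ => Node.dagger).eval c = c.spider n m (-θ) := by
  simp only [Colour.spider, Diagram.dagger, Diagram.eval, Colour.dagger_muls,
    Colour.dagger_comuls, MorColour.spider]
  exact (Mor.assoc _ _ _).symm

theorem spider_two_one_zero {c : MorColour R} (h : c (.phase 0) = Mor.mk R (.id 1)) :
    c.spider 2 1 0 = c .mul := by
  rw [spider_two_one, h, Mor.comp_id]

theorem spider_one_two_zero {c : MorColour R} (h : c (.phase 0) = Mor.mk R (.id 1)) :
    c.spider 1 2 0 = c .comul := by
  rw [spider_one_two, h, Mor.id_comp]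

theorem spider_one_one_zero {c : MorColour R} (h : c (.phase 0) = Mor.mk R (.id 1)) :
    c.spider 1 1 0 = Mor.mk R (.id 1) :=
  (c.spider_one_one 0).trans h

namespace IsSpider

theorem fusion (hc : c.IsSpider) (m n p q k : ℕ) (hk : 1 ≤ k) (α β : ZMod 4) :
    (((c.spider m (n + k) α).tensor (Mor.mk R (.id p))).comp
      (Mor.mk R (Diagram.ofEq (Nat.add_assoc n k p)))).comp
        ((Mor.mk R (.id n)).tensor (c.spider (k + p) q β)) = c.spider (m + p) (n + q) (α + β) := by
  have h := hc _ _ (.fusion m n p q k hk α β)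
  simp only [Colour.joined, Diagram.eval, Diagram.eval_ofEq] at h
  exact h

/-- The flipped fusion rule, with the right spider on top and the left one below. It gives the
mirror images needed for the right unit law, `frobenius_right` and the like. -/
theorem cofusion (hc : c.IsSpider) (m n p q k : ℕ) (hk : 1 ≤ k) (α β : ZMod 4) :
    ((Mor.mk R (.id n)).tensor (c.spider q (k + p) β)).comp
      ((Mor.mk R (Diagram.ofEq (Nat.add_assoc n k p).symm)).comp
        ((c.spider (n + k) m α).tensor (Mor.mk R (.id p))))
      = c.spider (n + q) (m + p) (α + β) := by
  have h := hc _ _ (.dagger (.fusion m n p q k hk (-α) (-β)))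
  simp only [Colour.joined, Diagram.dagger, Diagram.dagger_ofEq, Diagram.eval, Diagram.eval_ofEq,
    eval_dagger_spider, neg_neg, neg_add] at h
  exact h

theorem phase_add (hc : c.IsSpider) (α β : ZMod 4) :
    (c (.phase α)).comp (c (.phase β)) = c (.phase (α + β)) := by
  have h : ((((c.spider 1 1 α).tensor (Mor.mk R (.id 0))).comp (Mor.mk R (.id 1))).comp
    ((Mor.mk R (.id 0)).tensor (c.spider 1 1 β))) = c.spider 1 1 (α + β) :=
    hc.fusion 1 0 0 1 1 le_rfl α β
  have h2 : (Mor.mk R (.id 0)).tensor (c.spider 1 1 β) = c.spider 1 1 β :=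
    (Mor.comp_id _).symm.trans ((Mor.id_zero_tensor _).trans (Mor.id_comp _))
  rw [← spider_one_one c (α + β), ← h, h2, Mor.tensor_unit, Mor.comp_id, spider_one_one,
    spider_one_one]

/-- The Frobenius algebra of a colour. -/
def frobenius (hc : c.IsSpider) : PhasedFrobenius (⟨1⟩ : DiagCat R) :=
  have h0 := hc.phase_zero
  have hu := spider_zero_one h0
  have he := spider_one_zero h0
  have hm := spider_two_one_zero h0
  have hd := spider_one_two_zero h0
  have h1 := spider_one_one_zero h0
  -- For concrete arities `ofEq` reduces to the identity, so the coercion in the left unit law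
  -- disappears. Each law below is then fusion or cofusion along one wire with small arities, the
  -- unused legs being numbered 0.
  have I : ∀ f : Mor R 2 1, (Mor.mk R (.id 0)).tensor f = f := fun f =>
    (Mor.comp_id _).symm.trans ((Mor.id_zero_tensor _).trans (Mor.id_comp _))
  have J : ∀ f : Mor R 1 2, (Mor.mk R (.id 0)).tensor f = f := fun f =>
    (Mor.comp_id _).symm.trans ((Mor.id_zero_tensor _).trans (Mor.id_comp _))
  { u := c .unit
    e := c .counit
    m := c .mul
    d := c .comul
    ph := fun θ => c (.phase θ)
    ph_zero := h0
    ph_add := hc.phase_add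
    unit_mul := by
      have h : ((Mor.mk R (.id 1)).tensor (c.spider 0 1 0)).comp
          ((Mor.mk R (.id 2)).comp ((c.spider 2 1 0).tensor (Mor.mk R (.id 0)))) =
          c.spider 1 1 0 := hc.cofusion 1 1 0 0 1 le_rfl 0 0
      rw [hu, hm, h1, Mor.tensor_unit, Mor.id_comp] at h
      exact h
    mul_unit := by
      have h : (((c.spider 0 1 0).tensor (Mor.mk R (.id 1))).comp (Mor.mk R (.id 2))).comp
          ((Mor.mk R (.id 0)).tensor (c.spider 2 1 0)) = c.spider 1 1 0 :=
        hc.fusion 0 0 1 1 1 le_rfl 0 0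
      rw [hu, hm, h1, Mor.comp_id, I] at h
      exact h
    comul_counit := by
      have h : (((c.spider 1 2 0).tensor (Mor.mk R (.id 0))).comp (Mor.mk R (.id 2))).comp
          ((Mor.mk R (.id 1)).tensor (c.spider 1 0 0)) = c.spider 1 1 0 :=
        hc.fusion 1 1 0 0 1 le_rfl 0 0
      rw [he, hd, h1, Mor.tensor_unit, Mor.comp_id] at h
      exact h
    counit_comul := by
      have h : ((Mor.mk R (.id 0)).tensor (c.spider 1 2 0)).comp
          ((Mor.mk R (.id 2)).comp ((c.spider 1 0 0).tensor (Mor.mk R (.id 1)))) =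
          c.spider 1 1 0 := hc.cofusion 0 0 1 1 1 le_rfl 0 0
      rw [he, hd, h1, J, Mor.id_comp] at h
      exact h
    ph_mul_right := fun θ => by
      have h : ((Mor.mk R (.id 1)).tensor (c.spider 1 1 θ)).comp
          ((Mor.mk R (.id 2)).comp ((c.spider 2 1 0).tensor (Mor.mk R (.id 0)))) =
          c.spider 2 1 (0 + θ) := hc.cofusion 1 1 0 1 1 le_rfl 0 θ
      rw [hm, spider_one_one, Mor.tensor_unit, Mor.id_comp, zero_add, spider_two_one] at h
      exact h
    ph_mul_left := fun θ => by
      have h : (((c.spider 1 1 θ).tensor (Mor.mk R (.id 1))).comp (Mor.mk R (.id 2))).comp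
          ((Mor.mk R (.id 0)).tensor (c.spider 2 1 0)) = c.spider 2 1 (θ + 0) :=
        hc.fusion 1 0 1 1 1 le_rfl θ 0
      rw [hm, spider_one_one, I, Mor.comp_id, add_zero, spider_two_one] at h
      exact h
    ph_comul_right := fun θ => by
      have h : (((c.spider 1 2 0).tensor (Mor.mk R (.id 0))).comp (Mor.mk R (.id 2))).comp
          ((Mor.mk R (.id 1)).tensor (c.spider 1 1 θ)) = c.spider 1 2 (0 + θ) :=
        hc.fusion 1 1 0 1 1 le_rfl 0 θ
      rw [hd, spider_one_one, Mor.tensor_unit, Mor.comp_id, zero_add, spider_one_two] at h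
      exact h
    ph_comul_left := fun θ => by
      have h : ((Mor.mk R (.id 0)).tensor (c.spider 1 2 0)).comp
          ((Mor.mk R (.id 2)).comp ((c.spider 1 1 θ).tensor (Mor.mk R (.id 1)))) =
          c.spider 1 2 (θ + 0) := hc.cofusion 1 0 1 1 1 le_rfl θ 0
      rw [hd, spider_one_one, J, Mor.id_comp, add_zero, spider_one_two] at h
      exact h
    comm := hc _ _ .comm
    mul_assoc := by
      have h : (((c.spider 2 1 0).tensor (Mor.mk R (.id 1))).comp (Mor.mk R (.id 2))).comp
          ((Mor.mk R (.id 0)).tensor (c.spider 2 1 0)) = c.spider 3 1 0 :=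
        hc.fusion 2 0 1 1 1 le_rfl 0 0
      have h' : ((Mor.mk R (.id 1)).tensor (c.spider 2 1 0)).comp
          ((Mor.mk R (.id 2)).comp ((c.spider 2 1 0).tensor (Mor.mk R (.id 0)))) =
          c.spider 3 1 0 := hc.cofusion 1 1 0 2 1 le_rfl 0 0
      rw [hm, I, Mor.comp_id] at h
      rw [hm, Mor.tensor_unit, Mor.id_comp, ← h] at h'
      exact h'.symm.trans (Mor.id_comp (m := 3) _).symm
    comul_assoc := by
      have h : ((Mor.mk R (.id 0)).tensor (c.spider 1 2 0)).comp
          ((Mor.mk R (.id 2)).comp ((c.spider 1 2 0).tensor (Mor.mk R (.id 1)))) =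
          c.spider 1 3 0 := hc.cofusion 2 0 1 1 1 le_rfl 0 0
      have h' : (((c.spider 1 2 0).tensor (Mor.mk R (.id 0))).comp (Mor.mk R (.id 2))).comp
          ((Mor.mk R (.id 1)).tensor (c.spider 1 2 0)) = c.spider 1 3 0 :=
        hc.fusion 1 1 0 2 1 le_rfl 0 0
      rw [hd, J, Mor.id_comp] at h
      rw [hd, Mor.tensor_unit, Mor.comp_id, ← h] at h'
      exact (congrArg (Mor.comp (c .comul)) (Mor.comp_id (n := 3) _)).trans h'.symm
    frobenius_left := by
      have h : (((c.spider 1 2 0).tensor (Mor.mk R (.id 1))).comp (Mor.mk R (.id 3))).comp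
          ((Mor.mk R (.id 1)).tensor (c.spider 2 1 0)) = c.spider 2 2 0 :=
        hc.fusion 1 1 1 1 1 le_rfl 0 0
      rw [hd, hm, spider_two_two h0] at h
      exact (Mor.assoc _ _ _).symm.trans h
    frobenius_right := by
      have h : ((Mor.mk R (.id 1)).tensor (c.spider 1 2 0)).comp
          ((Mor.mk R (.id 3)).comp ((c.spider 2 1 0).tensor (Mor.mk R (.id 1)))) =
          c.spider 2 2 0 := hc.cofusion 1 1 1 1 1 le_rfl 0 0
      rw [hd, hm, spider_two_two h0] at h
      exact h }

end IsSpider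
end MorColour
end SpiderFrobenius

/-! ### The monoid of one-wire gates, and conjugate nodes -/

section General

variable {G : ℕ → ℕ → Type} {R : Rules G}

/-- Endomorphisms of one wire form a monoid under composition in diagrammatic order. -/
instance : Monoid (Mor R 1 1) where
  mul := Mor.comp
  one := Mor.mk R (.id 1)
  mul_assoc := Mor.assoc
  one_mul := Mor.id_comp
  mul_one := Mor.comp_id

theorem Mor.mk_eq {m n : ℕ} {f g : Diagram G m n} (h : R f g) : Mor.mk R f = Mor.mk R g :=
  Quotient.sound (DiagEq.rule h)

/-- The nodes of a colour in a presented category. -/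
def Colour.nodes (R : Rules G) (c : Colour G) : MorColour R :=
  c.under fun _ _ g => Mor.mk R (.gen g)

theorem Colour.mk_spider (c : Colour G) (m n : ℕ) (θ : ZMod 4) :
    Mor.mk R (c.spider m n θ) = (c.nodes R).spider m n θ :=
  (Diagram.eval_gen _).symm.trans (c.eval_spider _ m n θ)

theorem Mor.mk_power (f : Diagram G 1 1) (n : ℕ) : Mor.mk R (f.power n) = (Mor.mk R f).power n := by
  rw [← Diagram.eval_gen (R := R), Diagram.eval_power, Diagram.eval_gen]

theorem Mor.conj_conj {h h' : Mor R 1 1} (hh' : h.comp h' = Mor.mk R (.id 1)) {m n : ℕ}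
    (f : Mor R m n) : Mor.conj h' h (Mor.conj h h' f) = f := by
  simp only [Mor.conj, Mor.assoc]
  rw [Mor.power_comp_power, hh', Mor.id_power, Mor.comp_id,
    ← Mor.assoc, Mor.power_comp_power, hh', Mor.id_power, Mor.id_comp]

theorem MorColour.conj_conj (c : MorColour R) {h h' : Mor R 1 1}
    (hh' : h.comp h' = Mor.mk R (.id 1)) : (c.conj h h').conj h' h = c := by
  funext m n k
  exact Mor.conj_conj hh' _

/-- The spider rules for a colour that is compatible with flips. -/
theorem MorColour.Flips.isSpider [FlipRules R] {c : MorColour R} (hc : c.Flips)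
    (comm : (Mor.mk R (.swap 1 1)).comp (c .mul) = c .mul)
    (zero_label : ∀ m n, c.spider m n 0 = (Colour.self.plainSpider m n).eval c)
    (identity : (Colour.self.plainSpider 1 1).eval c = Mor.mk R (.id 1))
    (fusion : ∀ m n p q k, 1 ≤ k → ∀ α β,
      (Colour.self.joined m n p q k α β).eval c = c.spider (m + p) (n + q) (α + β)) :
    c.IsSpider := fun _ _ f g h => by
  induction h with
  | comm => exact comm
  | dagger _ ih => rw [Diagram.eval_dagger hc, Diagram.eval_dagger hc, ih]
  | zero_label m n => exact zero_label m n
  | identity => exact identity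
  | fusion m n p q k hk α β => exact fusion m n p q k hk α β

theorem StrictFunctor.map_power {G' : ℕ → ℕ → Type} {R' : Rules G'} (F : StrictFunctor R R')
    (f : Mor R 1 1) (n : ℕ) : F.map (f.power n) = (F.map f).power n := by
  induction n with
  | zero => exact F.map_id 0
  | succ n ih => exact (F.map_tensor _ _).trans (congrArg (fun z => Mor.tensor z _) ih)

theorem StrictFunctor.map_conj {G' : ℕ → ℕ → Type} {R' : Rules G'} (F : StrictFunctor R R')
    (h h' : Mor R 1 1) {m n : ℕ} (f : Mor R m n) :
    F.map (Mor.conj h h' f) = Mor.conj (F.map h) (F.map h') (F.map f) := by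
  simp only [Mor.conj, F.map_comp, F.map_power]

namespace MorColour

/-- The phase gates of a colour. -/
def ph (c : MorColour R) (θ : ZMod 4) : Mor R 1 1 := c (.phase θ)

theorem conj_unit (c : MorColour R) (h h' : Mor R 1 1) :
    c.conj h h' .unit = (c .unit).comp h :=
  (congrArg (fun z => Mor.comp z _) (Mor.id_comp _)).trans
    (congrArg (Mor.comp _) (Mor.power_one h))

theorem conj_mul (c : MorColour R) (h h' : Mor R 1 1) :
    c.conj h h' .mul = ((h'.tensor h').comp (c .mul)).comp h :=
  congrArg₂ (fun y z => Mor.comp (Mor.comp y _) z) (Mor.power_two h') (Mor.power_one h)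

theorem conj_comul (c : MorColour R) (h h' : Mor R 1 1) :
    c.conj h h' .comul = (h'.comp (c .comul)).comp (h.tensor h) :=
  congrArg₂ (fun y z => Mor.comp (Mor.comp y _) z) (Mor.power_one h') (Mor.power_two h)

theorem conj_counit (c : MorColour R) (h h' : Mor R 1 1) :
    c.conj h h' .counit = h'.comp (c .counit) :=
  (Mor.comp_id _).trans (congrArg (fun z => Mor.comp z _) (Mor.power_one h'))

theorem conj_ph (c : MorColour R) (h h' : Mor R 1 1) (θ : ZMod 4) :
    (c.conj h h').ph θ = h' * c.ph θ * h :=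
  congrArg₂ (fun y z => Mor.comp (Mor.comp y _) z) (Mor.power_one h') (Mor.power_one h)

theorem IsSpider.ph_mul_ph {c : MorColour R} (hc : c.IsSpider) (α β : ZMod 4) :
    c.ph α * c.ph β = c.ph (α + β) := hc.phase_add α β

theorem IsSpider.ph_zero {c : MorColour R} (hc : c.IsSpider) : c.ph 0 = 1 := hc.phase_zero

theorem IsSpider.ph_tensor_mul {c : MorColour R} (hc : c.IsSpider) (α β : ZMod 4) :
    ((c.ph α).tensor (c.ph β)).comp (c .mul) = (c .mul).comp (c.ph (α + β)) := by
  have hl : ((c.ph α).tensor (Mor.mk R (.id 1))).comp (c .mul) = (c .mul).comp (c.ph α) :=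
    hc.frobenius.ph_mul_left α
  have hr : ((Mor.mk R (.id 1)).tensor (c.ph β)).comp (c .mul) = (c .mul).comp (c.ph β) :=
    hc.frobenius.ph_mul_right β
  have e : (c.ph α).tensor (c.ph β) =
      ((c.ph α).tensor (Mor.mk R (.id 1))).comp ((Mor.mk R (.id 1)).tensor (c.ph β)) := by
    rw [Mor.tensor_comp_tensor, Mor.comp_id, Mor.id_comp]
  rw [e, Mor.assoc, hr, ← Mor.assoc, hl, Mor.assoc]
  exact congrArg _ (hc.phase_add α β)

end MorColour

end General

/-! ## The dichromatic calculus -/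

instance : FlipRules RGRule where
  flip := RGGen.dagger
  sound _ _ _ _ h := .rule (.dagger h)

namespace RG

theorem green_flips : (green.nodes RGRule).Flips := fun _ _ _ => rfl

theorem green_isSpider : (green.nodes RGRule).IsSpider := by
  refine green_flips.isSpider (Mor.mk_eq .green_comm) (fun m n => ?_) ?_ ?_
  · exact (green.mk_spider m n 0).symm.trans ((Mor.mk_eq ((.zero_label m n))).trans
      ((Diagram.eval_gen _).symm.trans (green.eval_plainSpider _ m n)))
  · exact ((green.eval_plainSpider _ 1 1).symm.trans (Diagram.eval_gen _)).trans
      (Mor.mk_eq .identity)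
  · intro m n p q k hk α β
    exact ((green.eval_joined _ m n p q k α β).symm.trans (Diagram.eval_gen _)).trans
      ((Mor.mk_eq ((.fusion m n p q k hk α β))).trans (green.mk_spider _ _ _))

theorem hadamard_comp_hadamard :
    (Mor.mk RGRule hadamard).comp (Mor.mk RGRule hadamard) = Mor.mk RGRule (.id 1) :=
  Mor.mk_eq .hadamard_sq

/-- The colour change rule for all spiders includes every node as a small spider. Hence red is a
conjugate of green and satisfies the spider rules, which are imposed on green alone. -/
theorem green_eq_conj : green.nodes RGRule =
    (red.nodes RGRule).conj (Mor.mk RGRule hadamard) (Mor.mk RGRule hadamard) := by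
  refine MorColour.ext_of_spider green_isSpider.phase_zero fun m n θ => ?_
  rw [← green.mk_spider]
  refine (Mor.mk_eq ((.colour_change m n θ))).trans ?_
  refine Eq.trans ?_
    (MorColour.eval_conj _ hadamard_comp_hadamard hadamard_comp_hadamard _).symm
  refine congrArg₂ Mor.comp (congrArg₂ Mor.comp (?_ : Mor.mk RGRule (hadamard.power m) = _)
    (?_ : Mor.mk RGRule (red.spider m n θ) = _)) (?_ : Mor.mk RGRule (hadamard.power n) = _)
  · exact Mor.mk_power _ _
  · exact red.mk_spider m n θ
  · exact Mor.mk_power _ _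

theorem red_eq_conj : red.nodes RGRule =
    (green.nodes RGRule).conj (Mor.mk RGRule hadamard) (Mor.mk RGRule hadamard) := by
  rw [green_eq_conj, MorColour.conj_conj _ hadamard_comp_hadamard]

end RG

/-! ## Phases of two colours related by the Euler decomposition -/

section Clifford

variable {M : Type*} [Monoid M]

/-- Two families of phases exchanged by an involution with an Euler decomposition. -/
structure Clifford (g r : ZMod 4 → M) (H : M) : Prop where
  g_mul (α β : ZMod 4) : g α * g β = g (α + β)
  g_zero : g 0 = 1
  H_sq : H * H = 1
  conj (θ : ZMod 4) : H * r θ * H = g θ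
  euler : H = g 1 * r 1 * g 1

namespace Clifford

variable {g r : ZMod 4 → M} {H : M}

theorem H_H (h : Clifford g r H) (x : M) : H * (H * x) = x := by
  rw [← mul_assoc, h.H_sq, one_mul]

theorem conj' (h : Clifford g r H) (θ : ZMod 4) : H * g θ * H = r θ := by
  simp only [← h.conj θ, mul_assoc, h.H_H, h.H_sq, mul_one]

theorem r_mul (h : Clifford g r H) (α β : ZMod 4) : r α * r β = r (α + β) := by
  simp only [← h.conj', ← h.g_mul, mul_assoc, h.H_H]

/-- Conjugating the Euler decomposition by `H` exchanges the colours and fixes `H`, so `H = r 1 * g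
1 * r 1` as well. -/
theorem symm (h : Clifford g r H) : Clifford r g H where
  g_mul := h.r_mul
  g_zero := by rw [← h.conj' 0, h.g_zero, mul_one, h.H_sq]
  H_sq := h.H_sq
  conj := h.conj'
  euler := by
    have e : H * (g 1 * r 1 * g 1) * H = H := by rw [← h.euler, h.H_sq, one_mul]
    refine e.symm.trans ?_
    simp only [← h.conj' 1, mul_assoc]

theorem g_mul_eq (h : Clifford g r H) {α β γ : ZMod 4} (e : α + β = γ) : g α * g β = g γ := by
  rw [h.g_mul, e]

theorem g_mul_assoc (h : Clifford g r H) (α β : ZMod 4) (x : M) :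
    g α * (g β * x) = g (α + β) * x := by
  rw [← mul_assoc, h.g_mul]

theorem euler_inv (h : Clifford g r H) : H = g 3 * r 3 * g 3 := by
  have hs := h.symm
  have e1 : (1 + 3 : ZMod 4) = 0 := rfl
  have e : H * (g 3 * r 3 * g 3) = 1 := by
    rw [h.euler]
    simp only [mul_assoc, h.g_mul_assoc, hs.g_mul_assoc, h.g_mul, e1, h.g_zero, hs.g_zero, one_mul]
  rw [← h.H_H (g 3 * r 3 * g 3), e, mul_one]

/-- The product `r 1 * g 1` is the rotation of the trichromatic calculus; this form shows that it
differs from `H` by a red phase. -/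
theorem r_g (h : Clifford g r H) : r 1 * g 1 = H * r 3 := by
  have e1 : (1 + 3 : ZMod 4) = 0 := rfl
  rw [h.symm.euler, mul_assoc, mul_assoc, h.symm.g_mul, e1, h.symm.g_zero, mul_one]

theorem r_g_sq (h : Clifford g r H) : (r 1 * g 1) * (r 1 * g 1) = r 1 * H := by
  conv_rhs => rw [h.euler]
  simp only [mul_assoc]

theorem r_g_sq' (h : Clifford g r H) : (r 1 * g 1) * (r 1 * g 1) = H * g 1 := by
  conv_rhs => rw [h.symm.euler]
  simp only [mul_assoc]

theorem r_g_inv (h : Clifford g r H) : (r 1 * g 1) * (r 1 * g 1) = g 3 * r 3 := by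
  rw [h.r_g_sq, h.symm.euler_inv, ← mul_assoc, ← mul_assoc, h.symm.g_mul]
  rw [show (1 + 3 : ZMod 4) = 0 from rfl, h.symm.g_zero, one_mul]

theorem r_g_cube (h : Clifford g r H) : (r 1 * g 1) * ((r 1 * g 1) * (r 1 * g 1)) = 1 := by
  have e1 : (3 + 1 : ZMod 4) = 0 := rfl
  rw [h.r_g_sq, h.r_g, mul_assoc, h.symm.g_mul_assoc, e1, h.symm.g_zero, one_mul, h.H_sq]

theorem pi_conj (h : Clifford g r H) (θ : ZMod 4) : g 2 * r θ * g 2 = r (-θ) := by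
  have hs := h.symm
  have e0 : g 2 * g 2 = 1 := (h.g_mul_eq rfl).trans h.g_zero
  have e1 : g 2 * r 1 * g 2 = r 3 := by
    -- Split each `g 2` into two quarter turns: the inner ones complete an Euler decomposition, and
    -- the inverse form of `H` cancels the outer ones.
    have a : g 2 * r 1 * g 2 = g 1 * H * g 1 := by
      rw [h.euler, ← h.g_mul_eq (show (1 + 1 : ZMod 4) = 2 from rfl)]
      simp only [mul_assoc]
    have b : (1 + 3 : ZMod 4) = 0 := rfl
    have c : (3 + 1 : ZMod 4) = 0 := rfl
    rw [a, h.euler_inv]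
    simp only [mul_assoc, h.g_mul_assoc, h.g_mul, b, c, h.g_zero, one_mul, mul_one]
  have key : ∀ α β : ZMod 4, g 2 * r α * g 2 = r (-α) → g 2 * r β * g 2 = r (-β) →
      g 2 * r (α + β) * g 2 = r (-(α + β)) := fun α β ha hb => by
    rw [neg_add, ← hs.g_mul (-α), ← ha, ← hb, ← hs.g_mul α]
    simp only [mul_assoc]
    rw [← mul_assoc (g 2) (g 2), e0, one_mul]
  have k1 : g 2 * r 1 * g 2 = r (-1) := e1
  have k2 := key 1 1 k1 k1
  have k3 := key (1 + 1) 1 k2 k1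
  -- Conjugation by `g 2` is multiplicative, so the generator 1 of `C₄` determines the other cases.
  fin_cases θ
  · change g 2 * r 0 * g 2 = r (-0)
    rw [neg_zero, hs.g_zero, mul_one, e0]
  · exact k1
  · exact k2
  · exact k3

theorem pi_commute (h : Clifford g r H) (θ : ZMod 4) : g 2 * r θ = r (-θ) * g 2 := by
  have e0 : g 2 * g 2 = 1 := (h.g_mul_eq rfl).trans h.g_zero
  rw [← h.pi_conj, mul_assoc, e0, mul_one]

theorem g_r_g (h : Clifford g r H) : g 3 * r 2 * g 1 = g 2 * r 2 := by
  have e := h.symm.pi_commute 1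
  have e1 : (3 + 3 : ZMod 4) = 2 := rfl
  have e2 : g 3 = g (-1) := rfl
  rw [mul_assoc, e, ← e2, ← mul_assoc, h.g_mul, e1]

/-- The phases of three colours related by the rotations of the trichromatic calculus. -/
theorem of_rotation {b : ZMod 4 → M} (g_mul : ∀ α β, g α * g β = g (α + β)) (g_zero : g 0 = 1)
    {R : M} (hgb : R = g 1 * b 1) (hrg : R = r 1 * g 1) (hbr : R = b 1 * r 1)
    (hb : ∀ θ, R * R * b θ * R = g θ) (hr : ∀ θ, R * r θ * (R * R) = g θ) :
    R * (R * R) = 1 ∧ Clifford g r (g 1 * r 1 * g 1) := by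
  -- At phase 0 the two colour changes exhibit a right inverse `r 0 * (R * R)` and a left inverse `R
  -- * R * b 0`.
  obtain ⟨u, rfl⟩ : IsUnit R := by
    refine isUnit_iff_exists.2 ⟨r 0 * (R * R), ?_, ?_⟩
    · rw [← mul_assoc, hr, g_zero]
    · have e1 : R * R * b 0 * R = 1 := (hb 0).trans g_zero
      have e2 : R * (r 0 * (R * R)) = 1 := by rw [← mul_assoc, hr, g_zero]
      have := left_inv_eq_right_inv e1 e2
      rw [← this, e1]
  have hb' : ∀ θ, b θ = ↑u⁻¹ * ↑u⁻¹ * g θ * ↑u⁻¹ := fun θ => by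
    rw [← hb]; simp [mul_assoc]
  have hr' : ∀ θ, r θ = ↑u⁻¹ * g θ * ↑u⁻¹ * ↑u⁻¹ := fun θ => by
    rw [← hr]; simp [mul_assoc]
  have h1 : (u : M) * u = g 1 * ↑u⁻¹ * ↑u⁻¹ * g 1 := by
    have : (u : M) * u = g 1 * b 1 * u := by rw [← hgb]
    rw [this, hb']; simp [mul_assoc]
  -- Expanding `R = b 1 * r 1` in green phases gives R = R⁻²(g₁R⁻²g₁)R⁻², and the bracket is R² by
  -- `h1`. Hence R³ = 1, and the colour changes are genuine conjugations.
  have h2 : (u : M) = ↑u⁻¹ * ↑u⁻¹ := by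
    have : (u : M) = ↑u⁻¹ * ↑u⁻¹ * (g 1 * ↑u⁻¹ * ↑u⁻¹ * g 1) * ↑u⁻¹ * ↑u⁻¹ := by
      conv_lhs => rw [hbr, hb', hr']
      simp [mul_assoc]
    rw [← h1] at this
    simpa [mul_assoc] using this
  have h3 : (u : M) * (u * u) = 1 := by
    conv_lhs => enter [1]; rw [h2]
    simp [mul_assoc]
  have h4 : ∀ θ, r θ = ↑u⁻¹ * g θ * u := fun θ => by
    rw [hr', mul_assoc _ (↑u⁻¹ : M), ← h2]
  have h5 : g 1 * r 1 * g 1 = g 1 * u := by rw [mul_assoc, ← hrg]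
  have h6 : (u : M) * u = g 1 * u * g 1 := by
    rw [h1, mul_assoc (g 1), ← h2]
  have h7 : g 1 * u = u * r 1 := by rw [h4]; simp [mul_assoc]
  have r_mul : ∀ α β, r α * r β = r (α + β) := fun α β => by
    rw [h4, h4, h4, ← g_mul]; simp [mul_assoc]
  have H_sq : g 1 * r 1 * g 1 * (g 1 * r 1 * g 1) = 1 := by
    rw [h5, ← mul_assoc, ← h6, mul_assoc, h3]
  refine ⟨h3, g_mul, g_zero, H_sq, fun θ => ?_, rfl⟩
  -- With H = Rr₁ on the left and H = r₃R⁻¹ on the right, the outer red phases cancel and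
  -- conjugation by H acts on red phases as conjugation by R does.
  have h8 : g 1 * r 1 * g 1 = r 3 * ↑u⁻¹ := by
    have e : (r 3 * ↑u⁻¹) * (g 1 * r 1 * g 1) = 1 := by
      have e1 : (3 + 1 : ZMod 4) = 0 := rfl
      rw [h5, h7, mul_assoc, Units.inv_mul_cancel_left, r_mul, e1, h4, g_zero]
      simp
    exact (left_inv_eq_right_inv e H_sq).symm
  conv_lhs => enter [2]; rw [h8]
  have e2 : (1 + θ + 3 : ZMod 4) = θ := by
    rw [add_right_comm]; exact zero_add θ
  rw [h5, h7, mul_assoc, mul_assoc, ← mul_assoc (r θ), r_mul, ← mul_assoc (r 1), r_mul,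
    ← add_assoc, e2, h4]
  simp [mul_assoc]

end Clifford
end Clifford

/-! ### Cups, caps and bent wires -/

section Bends

variable {G : ℕ → ℕ → Type} {R : Rules G}

namespace MorColour

/-- The node with no inputs and two outputs. -/
def cup (c : MorColour R) : Mor R 0 2 := (c .unit).comp (c .comul)

/-- The node with two inputs and no outputs. -/
def cap (c : MorColour R) : Mor R 2 0 := (c .mul).comp (c .counit)

/-- A map on the right one of two wires. -/
def onRight (f : Mor R 1 1) : Mor R 2 2 := (Mor.mk R (.id 1)).tensor f

/-- A map on the left one of two wires. -/
def onLeft (f : Mor R 1 1) : Mor R 2 2 := f.tensor (Mor.mk R (.id 1))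

/-- A wire bent by a cup and a cap. -/
def bend (u : Mor R 0 2) (a : Mor R 2 0) : Mor R 1 1 :=
  Mor.comp (m := 1) (n := 3) (p := 1) ((Mor.mk R (.id 1)).tensor u) (a.tensor (Mor.mk R (.id 1)))

variable {c : MorColour R}

theorem tensor_eq (f g : Mor R 1 1) : f.tensor g = (onLeft f).comp (onRight g) :=
  ((Mor.tensor_comp_tensor _ _ _ _).trans (congrArg₂ Mor.tensor (Mor.comp_id f)
    (Mor.id_comp g))).symm

theorem IsSpider.bend_eq (hc : c.IsSpider) (f g : Mor R 1 1) :
    bend (c.cup.comp (onRight g)) ((onLeft f).comp c.cap) = f * g := by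
  have h := hc.frobenius.dualize f g
  refine ((congrArg (Mor.comp _) (Mor.id_comp (m := 3) _)).symm.trans h).trans ?_
  exact (Mor.id_comp _).trans (congrArg (Mor.comp f) (Mor.comp_id g))

theorem IsSpider.cup_bend (hc : c.IsSpider) (u : Mor R 0 2) :
    c.cup.comp (onRight (bend u c.cap)) = u := by
  have h := hc.frobenius.cup_bend u
  refine Eq.trans (congrArg (fun z => c.cup.comp (onRight z)) ?_) h
  exact (((Mor.id_comp _).trans (congrArg (Mor.comp _) (Mor.id_comp (m := 3) _))).trans
    (congrArg (Mor.comp _) (Mor.comp_id _))).symm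

theorem IsSpider.unit_ph_comul (hc : c.IsSpider) (θ : ZMod 4) :
    ((c .unit).comp (c.ph θ)).comp (c .comul) = c.cup.comp (onRight (c.ph θ)) := by
  have h : (c .comul).comp (onRight (c.ph θ)) = (c.ph θ).comp (c .comul) :=
    hc.frobenius.ph_comul_right θ
  rw [cup, Mor.assoc, Mor.assoc, h]

theorem IsSpider.comul_tensor (hc : c.IsSpider) (α β : ZMod 4) :
    (c .comul).comp ((c.ph α).tensor (c.ph β)) = (c.ph (α + β)).comp (c .comul) := by
  have h (θ : ZMod 4) : (c .comul).comp (onRight (c.ph θ)) = (c.ph θ).comp (c .comul) :=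
    hc.frobenius.ph_comul_right θ
  have h' (θ : ZMod 4) : (c .comul).comp (onLeft (c.ph θ)) = (c.ph θ).comp (c .comul) :=
    hc.frobenius.ph_comul_left θ
  have e : (c.ph α).comp (c.ph β) = c.ph (α + β) := hc.phase_add α β
  rw [tensor_eq, ← Mor.assoc, h', Mor.assoc, h, ← Mor.assoc, e]

theorem IsSpider.cup_tensor (hc : c.IsSpider) (α β : ZMod 4) :
    c.cup.comp ((c.ph α).tensor (c.ph β)) = c.cup.comp (onRight (c.ph (α + β))) := by
  rw [← hc.unit_ph_comul, cup, Mor.assoc, hc.comul_tensor, Mor.assoc]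

theorem IsSpider.mul_ph_counit (hc : c.IsSpider) (θ : ZMod 4) :
    ((c .mul).comp (c.ph θ)).comp (c .counit) = (onLeft (c.ph θ)).comp c.cap := by
  have h : (onLeft (c.ph θ)).comp (c .mul) = (c .mul).comp (c.ph θ) :=
    hc.frobenius.ph_mul_left θ
  rw [cap, ← Mor.assoc, h]

theorem IsSpider.tensor_cap (hc : c.IsSpider) (α β : ZMod 4) :
    ((c.ph α).tensor (c.ph β)).comp c.cap = (onLeft (c.ph (α + β))).comp c.cap := by
  rw [← hc.mul_ph_counit, cap, ← Mor.assoc, hc.ph_tensor_mul]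

theorem IsSpider.unit_ph_mul (hc : c.IsSpider) (θ : ZMod 4) :
    Mor.comp (m := 1) (n := 2) (p := 1) ((Mor.mk R (.id 1)).tensor ((c .unit).comp (c.ph θ)))
      (c .mul) = c.ph θ := by
  have h : (onRight (c.ph θ)).comp (c .mul) = (c .mul).comp (c.ph θ) :=
    hc.frobenius.ph_mul_right θ
  have h' : Mor.comp (m := 1) (n := 2) (p := 1) ((Mor.mk R (.id 1)).tensor (c .unit)) (c .mul)
    = Mor.mk R (.id 1) := hc.frobenius.unit_mul
  have e : (Mor.mk R (.id 1)).tensor ((c .unit).comp (c.ph θ)) =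
      Mor.comp (m := 1) (n := 2) (p := 2) ((Mor.mk R (.id 1)).tensor (c .unit))
        (onRight (c.ph θ)) :=
    ((Mor.tensor_comp_tensor (Mor.mk R (.id 1)) (Mor.mk R (.id 1)) (c .unit) (c.ph θ)).trans
      (congrArg (fun z => Mor.tensor z ((c .unit).comp (c.ph θ))) (Mor.comp_id _))).symm
  refine (congrArg (fun z => Mor.comp z (c .mul)) e).trans ?_
  rw [Mor.assoc, h, ← Mor.assoc, h', Mor.id_comp]

theorem eval_dualizer {G' : ℕ → ℕ → Type} (φ : ∀ ⦃m n : ℕ⦄, G' m n → Mor R m n)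
    (c d : Colour G') : (c.dualizer d).eval φ = bend (c.under φ).cup (d.under φ).cap := rfl

end MorColour
end Bends

/-! ### Soundness of S in the quotient by the Euler decomposition -/

namespace RGPlus

open RG MorColour

/-- The Hadamard gate. -/
def hada : Mor RGPlusRule 1 1 := Mor.mk RGPlusRule hadamard

theorem hada_sq : hada.comp hada = Mor.mk RGPlusRule (.id 1) :=
  congrArg eulerQuotient.map hadamard_comp_hadamard

theorem green_isSpider : (green.nodes RGPlusRule).IsSpider := RG.green_isSpider.map eulerQuotient

theorem green_eq_conj : green.nodes RGPlusRule = (red.nodes RGPlusRule).conj hada hada := by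
  funext m n k
  have h := congrArg eulerQuotient.map (congrFun (congrFun (congrFun RG.green_eq_conj m) n) k)
  exact h.trans (eulerQuotient.map_conj _ _ _)

theorem red_eq_conj : red.nodes RGPlusRule = (green.nodes RGPlusRule).conj hada hada := by
  rw [green_eq_conj, MorColour.conj_conj _ hada_sq]

theorem red_isSpider : (red.nodes RGPlusRule).IsSpider := by
  rw [red_eq_conj]
  exact green_isSpider.conj hada_sq hada_sq

theorem clifford : Clifford (green.nodes RGPlusRule).ph (red.nodes RGPlusRule).ph hada where
  g_mul := green_isSpider.ph_mul_ph
  g_zero := green_isSpider.ph_zero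
  H_sq := hada_sq
  conj θ := by rw [green_eq_conj, conj_ph]
  euler := Mor.mk_eq .euler

end RGPlus

/-- The flip of the Euler rule is H = g₃r₃g₃, which is not among the rules but follows since H is an
involution. The spider rules used for this are transported from `RGRule`, which is closed under
flips by definition. -/
instance : FlipRules RGPlusRule where
  flip := RGGen.dagger
  sound _ _ _ _ h := by
    cases h with
    | rg h => exact .rule (.rg (.dagger h))
    | euler =>
      have e := RGPlus.clifford.euler_inv
      rw [mul_assoc] at e
      exact Quotient.exact e

namespace RGPlus

open RG MorColour

theorem green_flips : (green.nodes RGPlusRule).Flips := fun _ _ _ => rfl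

theorem copy : (red.nodes RGPlusRule .unit).comp (green.nodes RGPlusRule .comul)
    = (red.nodes RGPlusRule .unit).tensor (red.nodes RGPlusRule .unit) :=
  Mor.mk_eq (.rg .copy)

theorem red_unit_green (θ : ZMod 4) : (red.nodes RGPlusRule .unit).comp
    ((green.nodes RGPlusRule).ph θ) = red.nodes RGPlusRule .unit :=
  PhasedFrobenius.state_phase (fun s => Mor.scalar_eq s) green_isSpider.frobenius
    (v := red.nodes RGPlusRule .unit) (copy.trans (Mor.id_comp (m := 0) _).symm) θ

theorem green_unit : green.nodes RGPlusRule .unit = (red.nodes RGPlusRule .unit).comp hada := by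
  rw [green_eq_conj, conj_unit]

theorem red_unit : red.nodes RGPlusRule .unit = (green.nodes RGPlusRule .unit).comp hada := by
  rw [green_unit, Mor.assoc, hada_sq, Mor.comp_id]

theorem green_unit_red (θ : ZMod 4) : (green.nodes RGPlusRule .unit).comp
    ((red.nodes RGPlusRule).ph θ) = green.nodes RGPlusRule .unit := by
  have h : (red.nodes RGPlusRule).ph θ = hada.comp (((green.nodes RGPlusRule).ph θ).comp hada) :=
    (clifford.conj' θ).symm.trans (mul_assoc _ _ _)
  rw [h, ← Mor.assoc, ← red_unit, ← Mor.assoc, red_unit_green, ← green_unit]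

theorem green_copy : (green.nodes RGPlusRule .unit).comp (red.nodes RGPlusRule .comul)
    = (green.nodes RGPlusRule .unit).tensor (green.nodes RGPlusRule .unit) := by
  have h := congrArg (StrictFunctor.conj hada hada hada_sq hada_sq).map copy
  rw [StrictFunctor.map_comp, StrictFunctor.map_tensor] at h
  have e1 : (StrictFunctor.conj hada hada hada_sq hada_sq).map (red.nodes RGPlusRule .unit)
      = green.nodes RGPlusRule .unit :=
    (congrFun (congrFun (congrFun green_eq_conj 0) 1) Node.unit).symm
  have e2 : (StrictFunctor.conj hada hada hada_sq hada_sq).map (green.nodes RGPlusRule .comul)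
      = red.nodes RGPlusRule .comul :=
    (congrFun (congrFun (congrFun red_eq_conj 1) 2) Node.comul).symm
  rw [e1, e2] at h
  exact h

theorem cocopy : (red.nodes RGPlusRule .mul).comp (green.nodes RGPlusRule .counit)
    = (green.nodes RGPlusRule .counit).tensor (green.nodes RGPlusRule .counit) :=
  congrArg Mor.dagger green_copy

theorem cup_eq : (green.nodes RGPlusRule).cup = (red.nodes RGPlusRule).cup :=
  Mor.mk_eq (.rg .cups)

theorem cap_eq : (green.nodes RGPlusRule).cap = (red.nodes RGPlusRule).cap :=
  congrArg Mor.dagger cup_eq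

/-- In terms of states: u_r = u_g;H and Hr₃ = r₁g₁, while the green unit absorbs r₁. So the
translated red unit is the green state with phase 1. -/
theorem rotation : Mor.comp (m := 1) (n := 2) (p := 1) ((Mor.mk RGPlusRule (.id 1)).tensor
      ((red.nodes RGPlusRule .unit).comp ((red.nodes RGPlusRule).ph 3)))
      (green.nodes RGPlusRule .mul) = (green.nodes RGPlusRule).ph 1 := by
  have h : (red.nodes RGPlusRule .unit).comp ((red.nodes RGPlusRule).ph 3)
      = (green.nodes RGPlusRule .unit).comp ((green.nodes RGPlusRule).ph 1) := by
    have e : hada.comp ((red.nodes RGPlusRule).ph 3) =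
      ((red.nodes RGPlusRule).ph 1).comp ((green.nodes RGPlusRule).ph 1) := clifford.r_g.symm
    rw [red_unit, Mor.assoc, e, ← Mor.assoc, green_unit_red]
  exact (congrArg (fun z => Mor.comp (m := 1) (n := 2) (p := 1)
    ((Mor.mk RGPlusRule (.id 1)).tensor z) (green.nodes RGPlusRule .mul)) h).trans
    (green_isSpider.unit_ph_mul 1)

/-- The interpretation of trichromatic generators in the dichromatic calculus. -/
def trans ⦃m n : ℕ⦄ (g : RGBGen m n) : Mor RGPlusRule m n := Mor.mk RGPlusRule (translateS g)

theorem trans_flips ⦃m n : ℕ⦄ (g : RGBGen m n) : trans g.dagger = (trans g).dagger := by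
  cases g with
  | green k => rfl
  | red k => cases k <;> rfl
  | blue k =>
    cases k with
    | unit => rfl
    | counit => rfl
    | mul => exact Quotient.sound (DiagEq.assoc (RG.green.phase 3) RG.red.comul
        (RG.green.phase 1 ⊠ RG.green.phase 1))
    | comul => exact Quotient.sound (DiagEq.assoc (RG.green.phase 3 ⊠ RG.green.phase 3) RG.red.mul
        (RG.green.phase 1))
    | phase θ => exact Quotient.sound (DiagEq.assoc (RG.green.phase 3) (RG.red.phase (-θ))
        (RG.green.phase 1))

local notation "𝐠" => Colour.nodes RGPlusRule RG.green
local notation "𝐫" => Colour.nodes RGPlusRule RG.red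
local notation "𝐑" => Colour.under trans RGB.red
local notation "𝐁" => Colour.under trans RGB.blue

theorem red_trans_flips : MorColour.Flips 𝐑 := fun _ _ k => trans_flips (.red k)

theorem blue_trans_flips : MorColour.Flips 𝐁 := fun _ _ k => trans_flips (.blue k)

/-- The image of the colour changer. -/
def rot : Mor RGPlusRule 1 1 := RGB.right.eval trans

theorem rot_eq : rot = 𝐫.ph 1 * 𝐠.ph 1 := by
  have h : rot = 𝐠.ph 1 * (𝐠.ph 3 * 𝐫.ph 1 * 𝐠.ph 1) := rfl
  have e : (1 + 3 : ZMod 4) = 0 := rfl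
  rw [h, mul_assoc, clifford.g_mul_assoc, e, clifford.g_zero, one_mul]

theorem rot_rot_eq : rot * rot = 𝐠.ph 3 * 𝐫.ph 3 := by
  rw [rot_eq, clifford.r_g_inv]

theorem rot_cube : rot * (rot * rot) = 1 := by
  rw [rot_eq, clifford.r_g_cube]

theorem rot_cube' : rot * rot * rot = 1 := by
  rw [mul_assoc, rot_cube]

theorem rot_dagger : rot.dagger = rot * rot := by
  rw [rot_rot_eq, rot_eq]
  rfl

theorem rot_rot_dagger : (rot * rot).dagger = rot := by
  rw [rot_rot_eq, rot_eq]
  rfl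

theorem rot_eq_hada : rot = hada * 𝐫.ph 3 := by rw [rot_eq, clifford.r_g]

theorem rot_rot_eq_hada : rot * rot = 𝐫.ph 1 * hada := by rw [rot_eq, clifford.r_g_sq]

theorem rot_rot_eq_hada' : rot * rot = hada * 𝐠.ph 1 := by rw [rot_eq, clifford.r_g_sq']

theorem green_mul : 𝐠 .mul = ((hada.tensor hada).comp (𝐫 .mul)).comp hada := by
  rw [green_eq_conj, conj_mul]

/-- The green phases in the image of a blue multiplication or phase gate complete R² and R to H,
since R²g₃ = H = g₁R. Conjugating blue by the rotation therefore becomes conjugating red by H. At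
the unit the surplus phase r₃ is absorbed. -/
theorem green_eq_blue_conj : 𝐠 = MorColour.conj 𝐁 rot (rot * rot) := by
  refine green_flips.ext (blue_trans_flips.conj rot_dagger rot_rot_dagger) ?_ ?_ fun θ => ?_
  · rw [conj_unit]
    change _ = (𝐫 .unit).comp rot
    have e : rot = hada.comp (𝐫.ph 3) := rot_eq_hada
    rw [e, ← Mor.assoc, ← green_unit, green_unit_red]
  · rw [conj_mul]
    change _ = (((rot * rot).tensor (rot * rot)).comp
      ((((𝐠.ph 3).tensor (𝐠.ph 3)).comp (𝐫 .mul)).comp (𝐠.ph 1))).comp rot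
    have e1 : (rot * rot).comp (𝐠.ph 3) = hada := by
      rw [rot_rot_eq_hada']
      change hada * 𝐠.ph 1 * 𝐠.ph 3 = hada
      rw [mul_assoc, clifford.g_mul_eq (γ := 0) rfl, clifford.g_zero, mul_one]
    have e2 : (𝐠.ph 1).comp rot = hada := by
      rw [rot_eq]
      exact (mul_assoc _ _ _).symm.trans clifford.euler.symm
    simp only [Mor.assoc]
    rw [e2, ← Mor.assoc, Mor.tensor_comp_tensor, e1, ← Mor.assoc, green_mul]
  · refine Eq.trans ?_ (conj_ph 𝐁 _ _ θ).symm
    change 𝐠.ph θ = rot * rot * (𝐠.ph 3 * 𝐫.ph θ * 𝐠.ph 1) * rot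
    rw [rot_rot_eq_hada', rot_eq, ← clifford.conj θ]
    have e := clifford.euler
    rw [mul_assoc] at e
    have e1 : (1 + 3 : ZMod 4) = 0 := rfl
    simp only [mul_assoc, clifford.g_mul_assoc, e1, clifford.g_zero, one_mul]
    rw [← e]

/-- Here R = Hr₃ and R² = r₁H, and the phases added to the red nodes by the translation cancel the
surplus red phases. -/
theorem green_eq_red_conj : 𝐠 = MorColour.conj 𝐑 (rot * rot) rot := by
  have e0 : (𝐫.ph 3) * (rot * rot) = hada := by
    rw [rot_rot_eq_hada, ← mul_assoc, clifford.symm.g_mul_eq (γ := 0) rfl, clifford.symm.g_zero,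
      one_mul]
  refine green_flips.ext (red_trans_flips.conj rot_rot_dagger rot_dagger) ?_ ?_ fun θ => ?_
  · rw [conj_unit]
    change _ = ((𝐫 .unit).comp (𝐫.ph 3)).comp (rot * rot)
    rw [Mor.assoc]
    exact green_unit.trans (congrArg _ e0.symm)
  · rw [conj_mul]
    change _ = ((rot.tensor rot).comp ((𝐫 .mul).comp (𝐫.ph 1))).comp (rot * rot)
    have e : rot.tensor rot = (hada.tensor hada).comp ((𝐫.ph 3).tensor (𝐫.ph 3)) := by
      rw [Mor.tensor_comp_tensor, rot_eq_hada]; rfl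
    have e1 : (𝐫.ph (3 + 3)).comp ((𝐫.ph 1).comp (rot * rot)) = hada := by
      refine Eq.trans ?_ e0
      change 𝐫.ph (3 + 3) * (𝐫.ph 1 * (rot * rot)) = _
      rw [clifford.symm.g_mul_assoc]
      rfl
    rw [e, Mor.assoc, Mor.assoc, Mor.assoc, ← Mor.assoc ((𝐫.ph 3).tensor (𝐫.ph 3)) (𝐫 .mul),
      red_isSpider.ph_tensor_mul, Mor.assoc, e1, green_mul, Mor.assoc]
  · refine Eq.trans ?_ (conj_ph 𝐑 _ _ θ).symm
    change 𝐠.ph θ = rot * 𝐫.ph θ * (rot * rot)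
    rw [rot_rot_eq_hada, rot_eq_hada, ← clifford.conj θ]
    have e1 : (3 + (θ + 1) : ZMod 4) = θ := by
      rw [add_left_comm]; exact add_zero θ
    simp only [mul_assoc, clifford.symm.g_mul_assoc, e1]

/-- The red unit absorbs g₃, the red and green cups agree, and the two phases g₁ on the legs add up
to g₂. With the analogous facts for red, each dualizer rule becomes an identity between phases. -/
theorem blue_cup : MorColour.cup 𝐁 = 𝐠.cup.comp (onRight (𝐠.ph 2)) := by
  change (𝐫 .unit).comp (((𝐠.ph 3).comp (𝐫 .comul)).comp ((𝐠.ph 1).tensor (𝐠.ph 1))) = _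
  rw [Mor.assoc, ← Mor.assoc, red_unit_green, ← Mor.assoc]
  change 𝐫.cup.comp _ = _
  rw [← cup_eq, green_isSpider.cup_tensor]
  rfl

theorem blue_cap : MorColour.cap 𝐁 = (onLeft (𝐠.ph 2)).comp 𝐠.cap := by
  change ((((𝐠.ph 3).tensor (𝐠.ph 3)).comp (𝐫 .mul)).comp (𝐠.ph 1)).comp (𝐫 .counit) = _
  have h : (𝐠.ph 1).comp (𝐫 .counit) = 𝐫 .counit := congrArg Mor.dagger (red_unit_green 3)
  rw [Mor.assoc, h, Mor.assoc]
  change Mor.comp _ 𝐫.cap = _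
  rw [← cap_eq, green_isSpider.tensor_cap]
  rfl

theorem red_cup : MorColour.cup 𝐑 = 𝐠.cup.comp (onRight (𝐫.ph 2)) := by
  change ((𝐫 .unit).comp (𝐫.ph 3)).comp ((𝐫.ph 3).comp (𝐫 .comul)) = _
  have e : (𝐫.ph 3).comp (𝐫.ph 3) = 𝐫.ph 2 := clifford.symm.g_mul_eq rfl
  rw [← Mor.assoc, Mor.assoc (𝐫 .unit), e, red_isSpider.unit_ph_comul, cup_eq]

theorem red_cap : MorColour.cap 𝐑 = (onLeft (𝐫.ph 2)).comp 𝐠.cap := by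
  change ((𝐫 .mul).comp (𝐫.ph 1)).comp ((𝐫.ph 1).comp (𝐫 .counit)) = _
  have e : (𝐫.ph 1).comp (𝐫.ph 1) = 𝐫.ph 2 := clifford.symm.g_mul_eq rfl
  rw [← Mor.assoc, Mor.assoc (𝐫 .mul), e, red_isSpider.mul_ph_counit, cap_eq]

theorem onRight_one : onRight (1 : Mor RGPlusRule 1 1) = Mor.mk RGPlusRule (.id 2) :=
  Mor.id_tensor_id 1 1

theorem onLeft_one : onLeft (1 : Mor RGPlusRule 1 1) = Mor.mk RGPlusRule (.id 2) :=
  Mor.id_tensor_id 1 1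

theorem bend_cup (f : Mor RGPlusRule 1 1) : bend (𝐠.cup.comp (onRight f)) 𝐠.cap = f := by
  have h := green_isSpider.bend_eq 1 f
  rwa [onLeft_one, Mor.id_comp, one_mul] at h

theorem bend_cap (f : Mor RGPlusRule 1 1) : bend 𝐠.cup ((onLeft f).comp 𝐠.cap) = f := by
  have h := green_isSpider.bend_eq f 1
  rwa [onRight_one, Mor.comp_id, mul_one] at h

theorem trans_sound {m n : ℕ} {f g : Diagram RGBGen m n} (h : RGBRule f g) :
    f.eval trans = g.eval trans := by
  induction h with
  | red_comm =>
    have e : (Mor.mk RGPlusRule (.swap 1 1)).comp (𝐫 .mul) = 𝐫 .mul := Mor.mk_eq (.rg .red_comm)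
    exact (Mor.assoc _ _ _).symm.trans (congrArg (fun z => Mor.comp z (𝐫.ph 1)) e)
  | green_comm => exact Mor.mk_eq (.rg .green_comm)
  | blue_comm =>
    change (Mor.mk _ (.swap 1 1)).comp ((((𝐠.ph 3).tensor (𝐠.ph 3)).comp (𝐫 .mul)).comp (𝐠.ph 1))
      = (((𝐠.ph 3).tensor (𝐠.ph 3)).comp (𝐫 .mul)).comp (𝐠.ph 1)
    have e : (Mor.mk RGPlusRule (.swap 1 1)).comp (𝐫 .mul) = 𝐫 .mul := Mor.mk_eq (.rg .red_comm)
    rw [← Mor.assoc, ← Mor.assoc, ← Mor.swap_natural, Mor.assoc _ _ (𝐫 .mul), e]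
  | dagger _ ih => rw [Diagram.eval_dagger trans_flips, Diagram.eval_dagger trans_flips, ih]
  | zero_label m n =>
    exact (RGB.green.eval_spider _ _ _ _).trans
      ((green_isSpider _ _ (.zero_label m n)).trans (RGB.green.eval_plainSpider trans _ _).symm)
  | identity => exact green_isSpider _ _ .identity
  | fusion m n p q k hk α β =>
    exact (RGB.green.eval_joined _ _ _ _ _ _ _ _).trans
      ((green_isSpider _ _ (.fusion m n p q k hk α β)).trans (RGB.green.eval_spider trans _ _ _).symm)
  | copy => exact copy
  | cocopy =>
    change (((𝐫 .mul).comp (𝐫.ph 1)).comp (𝐫.ph 3)).comp (𝐠 .counit) = _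
    have e : (𝐫.ph 1).comp (𝐫.ph 3) = Mor.mk RGPlusRule (.id 1) :=
      (clifford.symm.g_mul_eq (γ := 0) rfl).trans clifford.symm.g_zero
    rw [Mor.assoc (𝐫 .mul), e, Mor.comp_id]
    exact cocopy
  | bialgebra =>
    have e : (𝐫.ph 1).comp (𝐫.ph 3) = Mor.mk RGPlusRule (.id 1) :=
      (clifford.symm.g_mul_eq (γ := 0) rfl).trans clifford.symm.g_zero
    have e' : ((𝐫 .mul).comp (𝐫.ph 1)).comp (𝐫.ph 3) = 𝐫 .mul := by
      rw [Mor.assoc, e, Mor.comp_id]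
    have h : Mor.mk RGPlusRule (RG.green.splitMerge RG.red.mul)
      = Mor.mk RGPlusRule (RG.red.mul ⨟ RG.green.comul) := Mor.mk_eq (.rg .bialgebra)
    rw [← Diagram.eval_gen, ← Diagram.eval_gen (R := RGPlusRule) (RG.red.mul ⨟ _)] at h
    refine Eq.trans (congrArg₂ Mor.comp rfl (congrArg₂ Mor.tensor e' e')) (h.trans ?_)
    exact congrArg₂ Mor.comp e'.symm rfl
  | rotation => exact rotation
  | right_red => exact rot_eq
  | right_blue =>
    refine rot_eq.trans ?_
    change _ = 𝐠.ph 3 * 𝐫.ph 1 * 𝐠.ph 1 * 𝐫.ph 1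
    have e := clifford.euler
    have e1 : (3 + 1 : ZMod 4) = 0 := rfl
    rw [mul_assoc, mul_assoc, ← mul_assoc (𝐫.ph 1), ← clifford.symm.euler, e]
    simp only [mul_assoc, clifford.g_mul_assoc, e1, clifford.g_zero, one_mul]
  | colour_change_blue m n θ =>
    rw [RGB.green.eval_spider]
    refine Eq.trans (congrArg₂ Mor.comp (congrArg₂ Mor.comp (Diagram.eval_power _ _ _)
      (RGB.blue.eval_spider _ _ _ _)) (Diagram.eval_power _ _ _)) ?_
    refine (MorColour.eval_conj 𝐁 rot_cube rot_cube' _).symm.trans ?_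
    rw [← green_eq_blue_conj]
    rfl
  | colour_change_red m n θ =>
    rw [RGB.green.eval_spider]
    refine Eq.trans ?_ (congrArg₂ Mor.comp (congrArg₂ Mor.comp (Diagram.eval_power _ _ _)
      (RGB.red.eval_spider _ _ _ _)) (Diagram.eval_power _ _ _)).symm
    refine Eq.trans ?_ (MorColour.eval_conj 𝐑 rot_cube' rot_cube _)
    rw [← green_eq_red_conj]
    rfl
  | yellow =>
    rw [eval_dualizer, eval_dualizer, red_cup, red_cap]
    exact (bend_cap _).trans (bend_cup _).symm
  | yellow_phase =>
    rw [eval_dualizer, red_cup]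
    exact bend_cup _
  | cyan =>
    rw [eval_dualizer, eval_dualizer, blue_cup, blue_cap]
    exact (bend_cup _).trans (bend_cap _).symm
  | cyan_phase =>
    rw [eval_dualizer, blue_cap]
    exact bend_cap _
  -- The two dualizers are g₂r₂ and r₂g₂ in opposite orders, so the rule says that half turns
  -- commute.
  | magenta =>
    rw [eval_dualizer, eval_dualizer, blue_cup, blue_cap, red_cup, red_cap,
      green_isSpider.bend_eq, green_isSpider.bend_eq]
    exact clifford.pi_commute 2
  | magenta_phase =>
    rw [eval_dualizer, blue_cup, red_cap, green_isSpider.bend_eq]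
    exact (clifford.pi_commute 2).symm.trans clifford.g_r_g.symm

end RGPlus

/-! ### Soundness of T in the trichromatic calculus -/

instance : FlipRules RGBRule where
  flip := RGBGen.dagger
  sound _ _ _ _ h := .rule (.dagger h)

namespace RGB

open MorColour

local notation "𝐠" => Colour.nodes RGBRule RGB.green
local notation "𝐫" => Colour.nodes RGBRule RGB.red
local notation "𝐛" => Colour.nodes RGBRule RGB.blue

theorem green_flips : MorColour.Flips 𝐠 := fun _ _ _ => rfl

theorem green_isSpider : MorColour.IsSpider 𝐠 := by
  refine green_flips.isSpider (Mor.mk_eq .green_comm) (fun m n => ?_) ?_ ?_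
  · exact (green.mk_spider m n 0).symm.trans ((Mor.mk_eq (.zero_label m n)).trans
      ((Diagram.eval_gen _).symm.trans (green.eval_plainSpider _ m n)))
  · exact ((green.eval_plainSpider _ 1 1).symm.trans (Diagram.eval_gen _)).trans
      (Mor.mk_eq .identity)
  · intro m n p q k hk α β
    exact ((green.eval_joined _ m n p q k α β).symm.trans (Diagram.eval_gen _)).trans
      ((Mor.mk_eq (.fusion m n p q k hk α β)).trans (green.mk_spider _ _ _))

/-- The colour changer. -/
def rot : Mor RGBRule 1 1 := Mor.mk RGBRule right

theorem rot_eq : rot = 𝐫.ph 1 * 𝐠.ph 1 := Mor.mk_eq .right_red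

theorem blue_spider (m n : ℕ) (θ : ZMod 4) :
    Mor.conj rot (rot * rot) (MorColour.spider 𝐛 m n θ) = MorColour.spider 𝐠 m n θ := by
  have h := Mor.mk_eq (RGBRule.colour_change_blue m n θ)
  rw [green.mk_spider] at h
  refine Eq.trans ?_ h
  exact congrArg₂ Mor.comp (congrArg₂ Mor.comp (Mor.mk_power left m).symm
    (blue.mk_spider m n θ).symm) (Mor.mk_power right n).symm

theorem red_spider (m n : ℕ) (θ : ZMod 4) :
    Mor.conj (rot * rot) rot (MorColour.spider 𝐫 m n θ) = MorColour.spider 𝐠 m n θ := by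
  have h := Mor.mk_eq (RGBRule.colour_change_red m n θ)
  rw [green.mk_spider] at h
  refine Eq.trans ?_ h.symm
  exact congrArg₂ Mor.comp (congrArg₂ Mor.comp (Mor.mk_power right m).symm
    (red.mk_spider m n θ).symm) (Mor.mk_power left n).symm

/-- The Hadamard gate. -/
def hada : Mor RGBRule 1 1 := 𝐠.ph 1 * 𝐫.ph 1 * 𝐠.ph 1

theorem rotation_relations : rot * (rot * rot) = 1 ∧ Clifford 𝐠.ph 𝐫.ph hada := by
  refine Clifford.of_rotation (b := 𝐛.ph) green_isSpider.ph_mul_ph green_isSpider.ph_zero rfl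
    rot_eq (Mor.mk_eq .right_blue) (fun θ => ?_) fun θ => ?_
  · have h := blue_spider 1 1 θ
    rw [spider_one_one, spider_one_one, Mor.conj, Mor.power_one, Mor.power_one] at h
    exact h
  · have h := red_spider 1 1 θ
    rw [spider_one_one, spider_one_one, Mor.conj, Mor.power_one, Mor.power_one] at h
    exact h

theorem clifford : Clifford 𝐠.ph 𝐫.ph hada := rotation_relations.2

theorem rot_cube : rot * (rot * rot) = 1 := rotation_relations.1

theorem rot_cube' : rot * rot * rot = 1 := by rw [mul_assoc, rot_cube]

theorem hada_sq : hada.comp hada = Mor.mk RGBRule (.id 1) := clifford.H_sq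

theorem rot_eq_hada : rot = hada * 𝐫.ph 3 := by rw [rot_eq, clifford.r_g]

theorem rot_rot_eq_hada : rot * rot = 𝐫.ph 1 * hada := by rw [rot_eq, clifford.r_g_sq]

theorem rot_rot_eq : rot * rot = 𝐠.ph 3 * 𝐫.ph 3 := by
  rw [rot_eq, clifford.r_g_inv]

theorem green_eq_blue_conj : 𝐠 = MorColour.conj 𝐛 rot (rot * rot) :=
  MorColour.ext_of_spider green_isSpider.phase_zero fun m n θ =>
    (blue_spider m n θ).symm.trans (MorColour.eval_conj 𝐛 rot_cube rot_cube' _).symm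

theorem green_eq_red_conj : 𝐠 = MorColour.conj 𝐫 (rot * rot) rot :=
  MorColour.ext_of_spider green_isSpider.phase_zero fun m n θ =>
    (red_spider m n θ).symm.trans (MorColour.eval_conj 𝐫 rot_cube' rot_cube _).symm

theorem blue_eq_conj : 𝐛 = MorColour.conj 𝐠 (rot * rot) rot := by
  rw [green_eq_blue_conj, MorColour.conj_conj _ rot_cube]

theorem red_eq_conj : 𝐫 = MorColour.conj 𝐠 rot (rot * rot) := by
  rw [green_eq_red_conj, MorColour.conj_conj _ rot_cube']

theorem red_isSpider : MorColour.IsSpider 𝐫 := by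
  rw [red_eq_conj]
  exact green_isSpider.conj rot_cube rot_cube'

/-- The interpretation of dichromatic generators in the trichromatic calculus. -/
def trans ⦃m n : ℕ⦄ (g : RGGen m n) : Mor RGBRule m n := Mor.mk RGBRule (translateT g)

theorem trans_flips ⦃m n : ℕ⦄ (g : RGGen m n) : trans g.dagger = (trans g).dagger := by
  cases g with
  | green k => rfl
  | red k => cases k <;> rfl
  | hadamard =>
    have e := clifford.euler_inv
    rw [mul_assoc] at e
    exact e

local notation "𝐑" => Colour.under trans RG.red

theorem red_trans_flips : MorColour.Flips 𝐑 := fun _ _ k => trans_flips (.red k)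

theorem hada_dagger : hada.dagger = hada := (trans_flips .hadamard).symm

/-- The rotation that relates green to red splits into H and a red phase; the red phases collected
at each node are exactly those that T adds to it. -/
theorem green_eq_conj : 𝐠 = MorColour.conj 𝐑 hada hada := by
  refine green_flips.ext (red_trans_flips.conj hada_dagger hada_dagger) ?_ ?_ fun θ => ?_
  · rw [green_eq_red_conj, conj_unit, conj_unit]
    change _ = ((𝐫 .unit).comp (𝐫.ph 1)).comp hada
    rw [rot_rot_eq_hada, Mor.assoc]
    rfl
  · rw [green_eq_red_conj, conj_mul, conj_mul]
    change _ = ((hada.tensor hada).comp ((𝐫 .mul).comp (𝐫.ph 3))).comp hada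
    have e : rot.tensor rot = (hada.tensor hada).comp ((𝐫.ph 3).tensor (𝐫.ph 3)) := by
      rw [Mor.tensor_comp_tensor, rot_eq_hada]; rfl
    have e1 : (𝐫.ph (3 + 3)).comp (rot * rot) = (𝐫.ph 3).comp hada := by
      rw [rot_rot_eq_hada]
      change 𝐫.ph (3 + 3) * (𝐫.ph 1 * hada) = _
      rw [clifford.symm.g_mul_assoc]
      rfl
    rw [e, Mor.assoc, Mor.assoc, ← Mor.assoc ((𝐫.ph 3).tensor (𝐫.ph 3)) (𝐫 .mul),
      red_isSpider.ph_tensor_mul, Mor.assoc, e1, Mor.assoc, Mor.assoc]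
  · exact (clifford.conj θ).symm.trans (conj_ph 𝐑 _ _ θ).symm

theorem trans_red_eq_conj : 𝐑 = MorColour.conj 𝐠 hada hada := by
  rw [green_eq_conj, MorColour.conj_conj _ hada_sq]

theorem trans_red_isSpider : MorColour.IsSpider 𝐑 := by
  rw [trans_red_eq_conj]
  exact green_isSpider.conj hada_sq hada_sq

theorem green_copy : (𝐠 .unit).comp (𝐑 .comul) = (𝐠 .unit).tensor (𝐠 .unit) :=
  congrArg Mor.dagger (Mor.mk_eq RGBRule.cocopy)

theorem green_unit_red (θ : ZMod 4) : (𝐠 .unit).comp (𝐫.ph θ) = 𝐠 .unit :=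
  PhasedFrobenius.state_phase (fun s => Mor.scalar_eq s) trans_red_isSpider.frobenius
    (v := 𝐠 .unit) (green_copy.trans (Mor.id_comp (m := 0) _).symm) θ

/-- Blue is green conjugated by R² = r₁H, and the green unit absorbs r₁, leaving u_g;H. This makes
the blue copy rule the copy rule that T requires. -/
theorem blue_unit : 𝐛 .unit = 𝐑 .unit := by
  rw [blue_eq_conj, conj_unit, trans_red_eq_conj, conj_unit, rot_rot_eq_hada]
  change (𝐠 .unit).comp ((𝐫.ph 1).comp hada) = _
  rw [← Mor.assoc, green_unit_red]

theorem copy : (𝐑 .unit).comp (𝐠 .comul) = (𝐑 .unit).tensor (𝐑 .unit) := by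
  rw [← blue_unit]
  exact Mor.mk_eq RGBRule.copy

/-- The dualizer of the green cup and the red cap is r₂; unbending it, the green cup is the red cup
with r₂ on one leg. T puts r₁ on both the red unit and the red comultiplication, so the translated
cup carries the same r₂. -/
theorem cup_eq : MorColour.cup 𝐠 = MorColour.cup 𝐑 := by
  have h : bend 𝐠.cup 𝐫.cap = 𝐫.ph 2 :=
    (Mor.mk_eq .yellow).trans (Mor.mk_eq .yellow_phase)
  rw [← red_isSpider.cup_bend 𝐠.cup, h]
  change _ = ((𝐫 .unit).comp (𝐫.ph 1)).comp ((𝐫.ph 1).comp (𝐫 .comul))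
  have e : (𝐫.ph 1).comp (𝐫.ph 1) = 𝐫.ph 2 := clifford.symm.g_mul_eq rfl
  rw [← Mor.assoc, Mor.assoc (𝐫 .unit), e, red_isSpider.unit_ph_comul]

theorem cap_eq : MorColour.cap 𝐠 = MorColour.cap 𝐑 := by
  have h := congrArg Mor.dagger cup_eq
  rw [cup, cup, Mor.dagger_comp, Mor.dagger_comp, ← green_flips .unit, ← green_flips .comul,
    ← red_trans_flips .unit, ← red_trans_flips .comul] at h
  exact h

theorem bialgebra : Mor.comp ((𝐠 .comul).tensor (𝐠 .comul))
    (Mor.comp (((Mor.mk RGBRule (.id 1)).tensor (Mor.mk RGBRule (.swap 1 1))).tensor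
      (Mor.mk RGBRule (.id 1))) ((𝐑 .mul).tensor (𝐑 .mul)))
    = (𝐑 .mul).comp (𝐠 .comul) :=
  (Mor.assoc _ _ _).symm.trans (Mor.mk_eq RGBRule.bialgebra)

theorem bialgebra' :
    PhasedFrobenius.Bialgebra green_isSpider.frobenius trans_red_isSpider.frobenius := by
  -- For these arities the associators in `tensorμ` are identities, so it is the crossing of the two
  -- middle wires.
  have h : tensorμ (⟨1⟩ : DiagCat RGBRule) ⟨1⟩ ⟨1⟩ ⟨1⟩ =
      ((Mor.mk RGBRule (.id 1)).tensor (Mor.mk RGBRule (.swap 1 1))).tensor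
        (Mor.mk RGBRule (.id 1)) := by
    have e : (((Mor.mk RGBRule (.id 1)).tensor (Mor.mk RGBRule (.swap 1 1))).tensor
        (Mor.mk RGBRule (.id 1)) : Mor RGBRule 4 4)
      = (Mor.mk RGBRule (.id 1)).tensor ((Mor.mk RGBRule (.swap 1 1)).tensor
        (Mor.mk RGBRule (.id 1))) := by
      have e1 : Mor.comp (((Mor.mk RGBRule (.id 1)).tensor (Mor.mk RGBRule (.swap 1 1))).tensor
          (Mor.mk RGBRule (.id 1)) : Mor RGBRule 4 4) (Mor.mk RGBRule (.id 4)) =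
          Mor.comp (Mor.mk RGBRule (.id 4)) ((Mor.mk RGBRule (.id 1)).tensor
            ((Mor.mk RGBRule (.swap 1 1)).tensor (Mor.mk RGBRule (.id 1))) : Mor RGBRule 4 4) :=
        associator_naturality (C := DiagCat RGBRule) (X₁ := ⟨1⟩) (X₂ := ⟨2⟩) (X₃ := ⟨1⟩)
          (Y₁ := ⟨1⟩) (Y₂ := ⟨2⟩) (Y₃ := ⟨1⟩) (Mor.mk RGBRule (.id 1)) (Mor.mk RGBRule (.swap 1 1))
          (Mor.mk RGBRule (.id 1))
      exact (Mor.comp_id (n := 4) _).symm.trans (e1.trans (Mor.id_comp (m := 4) _))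
    have i1 : ((Mor.mk RGBRule (.id 1)).tensor (Mor.mk RGBRule (.id 3)) : Mor RGBRule 4 4)
      = Mor.mk RGBRule (.id 4) := Mor.id_tensor_id 1 3
    refine Eq.trans ?_ e.symm
    have h0 : ∀ A J I : Mor RGBRule 4 4, J = I → I = Mor.mk RGBRule (.id 4) →
        I.comp (J.comp (A.comp (J.comp I))) = A := by
      rintro A _ _ rfl rfl
      simp only [Mor.id_comp, Mor.comp_id]
    exact h0 ((Mor.mk RGBRule (.id 1)).tensor ((Mor.mk RGBRule (.swap 1 1)).tensor
      (Mor.mk RGBRule (.id 1)))) _ _ i1 rfl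
  refine Eq.trans ?_ bialgebra
  refine congrArg (Mor.comp _) (congrArg (fun z => Mor.comp z _) h)

theorem hopf : (𝐠 .comul).comp (𝐑 .mul) = (𝐠 .counit).comp (𝐑 .unit) :=
  PhasedFrobenius.hopf bialgebra' cup_eq cap_eq
    (green_copy.trans (Mor.id_comp (m := 0) _).symm)

theorem pi_copy : (𝐫.ph 2).comp (𝐠 .comul) = (𝐠 .comul).comp ((𝐫.ph 2).tensor (𝐫.ph 2)) := by
  refine PhasedFrobenius.pi_copy (F := green_isSpider.frobenius)
    (K := trans_red_isSpider.frobenius) bialgebra' cup_eq ?_ ?_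
  · change (𝐑 .unit).comp (𝐫.ph 1) = (𝐠 .unit).comp (𝐠.ph 3)
    have e : hada.comp (𝐫.ph 1) = (𝐫.ph 3).comp (𝐠.ph 3) := by
      change hada * 𝐫.ph 1 = 𝐫.ph 3 * 𝐠.ph 3
      rw [clifford.symm.euler_inv, mul_assoc, clifford.symm.g_mul_eq (γ := 0) rfl,
        clifford.symm.g_zero, mul_one]
    rw [trans_red_eq_conj, conj_unit, Mor.assoc, e, ← Mor.assoc, green_unit_red]
  -- Writing g₃ = r₁Hr₁ moves the red phases out to r₂ at both ends. The two gates H turn the red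
  -- comultiplication into a green one, where the Hopf law applies.
  · change (𝐑 .comul).comp (((𝐠.ph 3).tensor (𝐠.ph 3)).comp (𝐑 .mul)) =
      (𝐫.ph 2).comp ((𝐑 .counit).comp ((𝐑 .unit).comp (𝐫.ph 2)))
    have e : 𝐠.ph 3 = (𝐑.ph 1).comp (hada.comp (𝐑.ph 1)) := by
      change 𝐠.ph 3 = 𝐫.ph 1 * (hada * 𝐫.ph 1)
      rw [clifford.symm.euler_inv, mul_assoc, clifford.symm.g_mul_eq (γ := 0) rfl,
        clifford.symm.g_zero, mul_one, clifford.symm.g_mul_assoc,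
        show (1 + 3 : ZMod 4) = 0 from rfl, clifford.symm.g_zero, one_mul]
    have hd : (𝐑 .comul).comp (hada.tensor hada) = hada.comp (𝐠 .comul) := by
      rw [trans_red_eq_conj, conj_comul, Mor.assoc, Mor.tensor_comp_tensor, hada_sq,
        Mor.id_tensor_id]
      exact Mor.comp_id _
    have he : hada.comp (𝐠 .counit) = 𝐑 .counit := by
      rw [trans_red_eq_conj, conj_counit]
    rw [e, ← Mor.tensor_comp_tensor, ← Mor.tensor_comp_tensor, Mor.assoc, Mor.assoc,
      ← Mor.assoc (𝐑 .comul), trans_red_isSpider.comul_tensor, trans_red_isSpider.ph_tensor_mul,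
      Mor.assoc, ← Mor.assoc (hada.tensor hada), ← Mor.assoc (𝐑 .comul), ← Mor.assoc (𝐑 .comul),
      hd, Mor.assoc hada, hopf, ← Mor.assoc hada, he, Mor.assoc]
    rfl

theorem trans_sound {m n : ℕ} {f g : Diagram RGGen m n} (h : RGRule f g) :
    f.eval trans = g.eval trans := by
  induction h with
  | green_comm => exact Mor.mk_eq .green_comm
  | red_comm =>
    have e : (Mor.mk RGBRule (.swap 1 1)).comp (𝐫 .mul) = 𝐫 .mul := Mor.mk_eq .red_comm
    exact (Mor.assoc _ _ _).symm.trans (congrArg (fun z => Mor.comp z (𝐫.ph 3)) e)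
  | dagger _ ih => rw [Diagram.eval_dagger trans_flips, Diagram.eval_dagger trans_flips, ih]
  | zero_label m n =>
    exact (RG.green.eval_spider _ _ _ _).trans
      ((green_isSpider _ _ (.zero_label m n)).trans (RG.green.eval_plainSpider trans _ _).symm)
  | identity => exact green_isSpider _ _ .identity
  | fusion m n p q k hk α β =>
    exact (RG.green.eval_joined _ _ _ _ _ _ _ _).trans
      ((green_isSpider _ _ (.fusion m n p q k hk α β)).trans
        (RG.green.eval_spider trans _ _ _).symm)
  | bialgebra => exact Mor.mk_eq .bialgebra
  | copy => exact copy
  | cups => exact cup_eq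
  | pi_copy => exact pi_copy
  | pi_commute θ => exact clifford.pi_commute θ
  | hadamard_sq => exact hada_sq
  | colour_change m n θ =>
    rw [RG.green.eval_spider]
    refine Eq.trans ?_ (congrArg₂ Mor.comp (congrArg₂ Mor.comp (Diagram.eval_power _ _ _)
      (RG.red.eval_spider _ _ _ _)) (Diagram.eval_power _ _ _)).symm
    refine Eq.trans ?_ (MorColour.eval_conj 𝐑 hada_sq hada_sq _)
    rw [← green_eq_conj]
    rfl

theorem trans_sound_plus {m n : ℕ} {f g : Diagram RGGen m n} (h : RGPlusRule f g) :
    f.eval trans = g.eval trans := by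
  cases h with
  | rg h => exact trans_sound h
  | euler => rfl

/-- Conjugation by the rotation permutes the colours cyclically, and g₃ = R²r₁, g₁ = r₃R show that
the left side is R²r_θR, the blue phase. -/
theorem blue_phase (θ : ZMod 4) : 𝐠.ph 3 * 𝐫.ph θ * 𝐠.ph 1 = 𝐛.ph θ := by
  have hb : 𝐛.ph θ = rot * 𝐠.ph θ * (rot * rot) := by rw [blue_eq_conj, conj_ph]
  have hr : 𝐫.ph θ = rot * rot * 𝐠.ph θ * rot := by
    conv_lhs => rw [red_eq_conj, conj_ph]
  have h1 : 𝐠.ph 3 = rot * rot * 𝐫.ph 1 := by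
    rw [rot_rot_eq, mul_assoc, clifford.symm.g_mul_eq (γ := 0) rfl, clifford.symm.g_zero, mul_one]
  have h2 : 𝐠.ph 1 = 𝐫.ph 3 * rot := by
    rw [rot_eq, clifford.symm.g_mul_assoc, show (3 + 1 : ZMod 4) = 0 from rfl,
      clifford.symm.g_zero, one_mul]
  have e : (1 + (θ + 3) : ZMod 4) = θ := by
    rw [add_left_comm]; exact add_zero θ
  have h3 : 𝐠.ph 3 * 𝐫.ph θ * 𝐠.ph 1 = rot * rot * 𝐫.ph θ * rot := by
    rw [h1, h2]
    simp only [mul_assoc, clifford.symm.g_mul_assoc, e]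
  have c : ∀ x, rot * (rot * (rot * x)) = x := fun x => by
    have := congrArg (· * x) rot_cube
    simpa only [mul_assoc, one_mul] using this
  rw [h3, hr, hb]
  simp only [mul_assoc, c]

theorem blue_mul : ((((𝐠.ph 3).tensor (𝐠.ph 3)).comp ((𝐫 .mul).comp (𝐫.ph 3))).comp (𝐠.ph 1))
    = 𝐛 .mul := by
  have c : (rot * rot).comp ((rot * rot)) = rot := by
    change rot * rot * (rot * rot) = rot
    rw [mul_assoc, rot_cube, mul_one]
  -- Passing from red to green and on to blue conjugates twice by R², which is one conjugation by R
  -- because R³ = 1.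
  have hb : 𝐛 .mul = (((rot * rot).tensor (rot * rot)).comp (𝐫 .mul)).comp rot := by
    rw [blue_eq_conj, conj_mul, green_eq_red_conj, conj_mul]
    simp only [Mor.assoc]
    rw [c, ← Mor.assoc (rot.tensor rot), Mor.tensor_comp_tensor]
    rfl
  have e1 : (rot * rot).tensor (rot * rot) =
      ((𝐠.ph 3).tensor (𝐠.ph 3)).comp ((𝐫.ph 3).tensor (𝐫.ph 3)) := by
    rw [Mor.tensor_comp_tensor, rot_rot_eq]; rfl
  have e2 : (𝐫.ph (3 + 3)).comp rot = (𝐫.ph 3).comp (𝐠.ph 1) := by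
    rw [rot_eq]
    change 𝐫.ph (3 + 3) * (𝐫.ph 1 * 𝐠.ph 1) = _
    rw [clifford.symm.g_mul_assoc]
    rfl
  rw [hb, e1, Mor.assoc _ _ (𝐫 .mul), red_isSpider.ph_tensor_mul, Mor.assoc, Mor.assoc,
    Mor.assoc, Mor.assoc, e2]

theorem phase_cancel {α β : ZMod 4} (h : α + β = 0) :
    (𝐫.ph α).comp (𝐫.ph β) = Mor.mk RGBRule (.id 1) :=
  (clifford.symm.g_mul_eq h).trans clifford.symm.g_zero

theorem eval_translateS ⦃m n : ℕ⦄ (g : RGBGen m n) :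
    (translateS g).eval trans = Mor.mk RGBRule (.gen g) := by
  cases g with
  | green k => rfl
  | red k =>
    cases k with
    | unit =>
      change ((𝐫 .unit).comp (𝐫.ph 1)).comp (𝐫.ph 3) = 𝐫 .unit
      rw [Mor.assoc, phase_cancel rfl, Mor.comp_id]
    | counit =>
      change (𝐫.ph 1).comp ((𝐫.ph 3).comp (𝐫 .counit)) = 𝐫 .counit
      rw [← Mor.assoc, phase_cancel rfl, Mor.id_comp]
    | mul =>
      change ((𝐫 .mul).comp (𝐫.ph 3)).comp (𝐫.ph 1) = 𝐫 .mul
      rw [Mor.assoc, phase_cancel rfl, Mor.comp_id]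
    | comul =>
      change (𝐫.ph 3).comp ((𝐫.ph 1).comp (𝐫 .comul)) = 𝐫 .comul
      rw [← Mor.assoc, phase_cancel rfl, Mor.id_comp]
    | phase θ => rfl
  | blue k =>
    cases k with
    | unit => exact blue_unit.symm
    | counit => exact (congrArg Mor.dagger blue_unit).symm
    | mul => exact blue_mul
    | comul => exact (Mor.assoc _ _ _).trans (congrArg Mor.dagger blue_mul)
    | phase θ => exact blue_phase θ

end RGB

/-! ### The composite of T and S fixes the dichromatic generators -/

namespace RGPlus

open MorColour

local notation "𝐠" => Colour.nodes RGPlusRule RG.green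
local notation "𝐫" => Colour.nodes RGPlusRule RG.red

theorem phase_cancel {α β : ZMod 4} (h : α + β = 0) :
    (𝐫.ph α).comp (𝐫.ph β) = Mor.mk RGPlusRule (.id 1) :=
  (clifford.symm.g_mul_eq h).trans clifford.symm.g_zero

theorem eval_translateT ⦃m n : ℕ⦄ (g : RGGen m n) :
    (translateT g).eval trans = Mor.mk RGPlusRule (.gen g) := by
  cases g with
  | green k => rfl
  | red k =>
    cases k with
    | unit =>
      change ((𝐫 .unit).comp (𝐫.ph 3)).comp (𝐫.ph 1) = 𝐫 .unit
      rw [Mor.assoc, phase_cancel rfl, Mor.comp_id]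
    | counit =>
      change (𝐫.ph 3).comp ((𝐫.ph 1).comp (𝐫 .counit)) = 𝐫 .counit
      rw [← Mor.assoc, phase_cancel rfl, Mor.id_comp]
    | mul =>
      change ((𝐫 .mul).comp (𝐫.ph 1)).comp (𝐫.ph 3) = 𝐫 .mul
      rw [Mor.assoc, phase_cancel rfl, Mor.comp_id]
    | comul =>
      change (𝐫.ph 1).comp ((𝐫.ph 3).comp (𝐫 .comul)) = 𝐫 .comul
      rw [← Mor.assoc, phase_cancel rfl, Mor.id_comp]
    | phase θ => rfl
  | hadamard => exact clifford.euler.symm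

end RGPlus

/-! ## The translations as functors -/

namespace StrictFunctor

variable {G₁ G₂ G₃ : ℕ → ℕ → Type} {R₁ : Rules G₁} {R₂ : Rules G₂} {R₃ : Rules G₃}

/-- The identity functor. -/
protected def id (R : Rules G₁) : StrictFunctor R R where
  map f := f
  map_id _ := rfl
  map_comp _ _ := rfl
  map_tensor _ _ := rfl
  map_swap _ _ := rfl

/-- Composition of strict symmetric monoidal functors. -/
protected def comp (F : StrictFunctor R₁ R₂) (F' : StrictFunctor R₂ R₃) : StrictFunctor R₁ R₃ where
  map f := F'.map (F.map f)
  map_id n := by rw [F.map_id, F'.map_id]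
  map_comp f g := by rw [F.map_comp, F'.map_comp]
  map_tensor f g := by rw [F.map_tensor, F'.map_tensor]
  map_swap m n := by rw [F.map_swap, F'.map_swap]

end StrictFunctor

/-- A functor out of a quotient of a presented category is determined by its composite with the
quotient functor. -/
theorem quotientFunctor_cancel {G₁ G₂ : ℕ → ℕ → Type} {R₁ R₁' : Rules G₁} {R₂ : Rules G₂}
    (h : ∀ ⦃m n : ℕ⦄ (f g : Diagram G₁ m n), R₁ f g → R₁' f g)
    {F F' : DiagCat R₁' ⥤ DiagCat R₂}
    (e : (quotientFunctor R₁ R₁' h).toFunctor ⋙ F = (quotientFunctor R₁ R₁' h).toFunctor ⋙ F') :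
    F = F' := by
  refine CategoryTheory.Functor.hext (fun X => ?_) fun X Y f => ?_
  · exact congrArg (fun K : DiagCat R₁ ⥤ DiagCat R₂ => K.obj ⟨X.arity⟩) e
  · induction f using Quotient.inductionOn with
    | h f =>
      -- The same diagram represents a preimage under the quotient functor. Values are compared by
      -- heterogeneous equality, since the two functors agree on objects only through `e`.
      let f' : (⟨X.arity⟩ : DiagCat R₁) ⟶ ⟨Y.arity⟩ := Mor.mk R₁ f
      have e' : ∀ {K K' : DiagCat R₁ ⥤ DiagCat R₂}, K = K' → K.map f' ≍ K'.map f' := by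
        rintro _ _ rfl; rfl
      exact e' e

end Chromatic

/-- The translation `T` on generators extends uniquely to a strict symmetric monoidal functor
`RG → RGB`, which lifts uniquely along the quotient functor to `That : RG⁺ → RGB`; the translation
`S` on generators extends uniquely to a strict symmetric monoidal functor `RGB → RG⁺`; and `S` and
`That` are inverse to each other, so that `RGB` and `RG⁺` are isomorphic categories. -/
theorem mainTheorem1 :
    ∃ (T : StrictFunctor RGRule RGBRule) (That : StrictFunctor RGPlusRule RGBRule)
      (S : StrictFunctor RGBRule RGPlusRule),
      (T.ActsBy translateT ∧
        ∀ T' : StrictFunctor RGRule RGBRule, T'.ActsBy translateT → T' = T) ∧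
      (eulerQuotient.toFunctor ⋙ That.toFunctor = T.toFunctor ∧
        ∀ F : RGPlusCat ⥤ RGBCat, eulerQuotient.toFunctor ⋙ F = T.toFunctor →
          F = That.toFunctor) ∧
      (S.ActsBy translateS ∧
        ∀ S' : StrictFunctor RGBRule RGPlusRule, S'.ActsBy translateS → S' = S) ∧
      S.toFunctor ⋙ That.toFunctor = 𝟭 RGBCat ∧
      That.toFunctor ⋙ S.toFunctor = 𝟭 RGPlusCat := by
  let T : StrictFunctor RGRule RGBRule := .lift RGB.trans fun _ _ _ _ => RGB.trans_sound
  let That : StrictFunctor RGPlusRule RGBRule :=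
    .lift RGB.trans fun _ _ _ _ => RGB.trans_sound_plus
  let S : StrictFunctor RGBRule RGPlusRule := .lift RGPlus.trans fun _ _ _ _ => RGPlus.trans_sound
  have hT : eulerQuotient.comp That = T := StrictFunctor.ext_gen fun _ _ _ => rfl
  have hT' : eulerQuotient.toFunctor ⋙ That.toFunctor = T.toFunctor :=
    congrArg StrictFunctor.toFunctor hT
  refine ⟨T, That, S, ⟨fun _ _ _ => rfl, fun T' h => StrictFunctor.ext_gen h⟩,
    ⟨hT', fun F h => quotientFunctor_cancel _ (h.trans hT'.symm)⟩,
    ⟨fun _ _ _ => rfl, fun S' h => StrictFunctor.ext_gen h⟩, ?_, ?_⟩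
  · have h : S.comp That = StrictFunctor.id RGBRule :=
      StrictFunctor.ext_gen fun _ _ g => RGB.eval_translateS g
    exact congrArg StrictFunctor.toFunctor h
  · have h : That.comp S = StrictFunctor.id RGPlusRule :=
      StrictFunctor.ext_gen fun _ _ g => RGPlus.eval_translateT g
    exact congrArg StrictFunctor.toFunctor h
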